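/- For a set $K\subseteq\mathbb{R}^d$ let $w(K)=\mathbb{E}\big[\sup_{v\in K}|\langle g,v\rangle|\big]\in[0,\infty]$, $g\sim N(0,I_d)$, be its Gaussian width (with $\sup_\emptyset=0$). Let $B_2$ and $\mathbb{S}$ denote the closed Euclidean unit ball and the unit sphere of $\mathbb{R}^d$. For a signal class $\mathcal{K}\subseteq\mathbb{R}^d$ put $\mathcal{C}=\mathcal{K}\cap B_2$ and, for a unit vector $x_u\in\mathcal{K}$, put $$\overline{\Delta}(\mathcal{C})=\{\alpha(x-x_u):\alpha\ge 0,\ x\in\mathcal{C}\}\cap\mathbb{S}.$$ Let $\|x\|_0$ be the number of nonzero entries of $x$, and $B_0(r;n)=\{x\in\mathbb{R}^n:\|x\|_0\le r\}$. The following hold for every unit vector $x_u\in\mathcal{K}$. 1. (Sparsity) If $1\le s$, $2s\le n$ and $\mathcal{K}=B_0(s;n)$, then $$w(\overline{\Delta}(\mathcal{C}))\le w(B_0(2s;n)\cap\mathbb{S})\le \sqrt{2s}+\sqrt{4s\log\tfrac{en}{2s}}+\sqrt{\pi/2}\le 3.5\sqrt{2s\log\tfrac{en}{2s}}.$$ 2.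 (Fused sparsity) Let $D:\mathbb{R}^n\to\mathbb{R}^{n-1}$, $(Dx)_i=x_{i+1}-x_i$. If $1\le s$, $2s\le n$ and $\mathcal{K}=\{x\in\mathbb{R}^n: Dx\in B_0(s;n-1)\}$, then $$w(\overline{\Delta}(\mathcal{C}))\le \sqrt{2s}+\sqrt{4s\log\tfrac{en}{2s}}+\sqrt{\pi/2}\quad\text{and}\quad w(\overline{\Delta}(\mathcal{C}))\le 3.5\sqrt{2s\log\tfrac{en}{2s}}.$$ 3. (Group sparsity) Let $G_1,\dots,G_L$ be pairwise disjoint sets with union $\{1,\dots,n\}$ (some may be empty), let $1\le s$, $2s\le L$, and let $\mathcal{K}$ be the set of $x\in\mathbb{R}^n$ for which at most $s$ of the subvectors $x_{G_\ell}$ are nonzero. Then $$w(\overline{\Delta}(\mathcal{C}))\le 2\sqrt{2s\max_{1\le \ell\le L}|G_\ell|}+\sqrt{4s\log\tfrac{eL}{2s}}.$$ 4. (Low-rank matrices) Identify $\mathbb{R}^{n_1\times n_2}$ with $\mathbb{R}^{n_1n_2}$, so that the Euclidean norm is the Frobenius norm. If $\mathcal{K}=\{X\in\mathbb{R}^{n_1\times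 n_2}:\operatorname{rank}(X)\le s\}$, then $$w(\overline{\Delta}(\mathcal{C}))\le\sqrt{2sn_1}+\sqrt{2sn_2}.$$ 5. ($\ell_1$-ball constraint) If $x_u\in B_0(s;n)$ and $\mathcal{K}=\{x\in\mathbb{R}^n:\|x\|_1\le\|x_u\|_1\}$, then $$w(\overline{\Delta}(\mathcal{C}))\le 2\sqrt2\; w(B_0(2s;n)\cap\mathbb{S}),$$ and hence, if $2s\le n$, $w(\overline{\Delta}(\mathcal{C}))\le 2\sqrt2\cdot 3.5\sqrt{2s\log\tfrac{en}{2s}}$. -/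

import Mathlib

open MeasureTheory ProbabilityTheory
open scoped ENNReal

noncomputable section

/-- `E[sup_{v ∈ K} |⟨g, v⟩|]` for a standard Gaussian vector `g`, as an element of `[0, ∞]`.
The supremum over the empty set is `0`. -/
def gaussianWidth {E : Type*} [NormedAddCommGroup E] [InnerProductSpace ℝ E]
    [FiniteDimensional ℝ E] [MeasurableSpace E] [BorelSpace E] (K : Set E) : ℝ≥0∞ :=
  ∫⁻ g, ⨆ v ∈ K, ENNReal.ofReal |inner ℝ g v| ∂(stdGaussian E)

/-- The cone `{α (x - x₀) : α ≥ 0, x ∈ C}`. -/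
def tangentCone {E : Type*} [NormedAddCommGroup E] [InnerProductSpace ℝ E]
    (C : Set E) (x₀ : E) : Set E :=
  {v | ∃ α : ℝ, 0 ≤ α ∧ ∃ x ∈ C, v = α • (x - x₀)}

/-- The spherical part of the tangent cone at `x₀` of `C = K ∩ B₂`, for a signal class `K`. -/
def sphericalTangent {E : Type*} [NormedAddCommGroup E] [InnerProductSpace ℝ E]
    (K : Set E) (x₀ : E) : Set E :=
  tangentCone (K ∩ Metric.closedBall 0 1) x₀ ∩ Metric.sphere 0 1

/-- The number of nonzero entries of a vector. -/
def l0norm {n : ℕ} (x : EuclideanSpace ℝ (Fin n)) : ℕ := {j | x j ≠ 0}.ncard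

/-- The `r`-sparse vectors of `ℝⁿ`. -/
def sparseSet (r n : ℕ) : Set (EuclideanSpace ℝ (Fin n)) := {x | l0norm x ≤ r}

/-- The first-order difference operator `ℝⁿ → ℝⁿ⁻¹`, `(Dx)ᵢ = xᵢ₊₁ - xᵢ`. -/
def firstDiff {n : ℕ} (x : EuclideanSpace ℝ (Fin n)) : EuclideanSpace ℝ (Fin (n - 1)) :=
  WithLp.toLp 2 fun i => x ⟨i.1 + 1, by omega⟩ - x ⟨i.1, by omega⟩

/-- Piecewise constant signals in `ℝⁿ` with at most `s` breakpoints. -/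
def piecewiseConstantSet (s n : ℕ) : Set (EuclideanSpace ℝ (Fin n)) :=
  {x | firstDiff x ∈ sparseSet s (n - 1)}

/-- The vectors which are nonzero on at most `r` of the groups `G ℓ`. -/
def groupSparseSet {n L : ℕ} (G : Fin L → Finset (Fin n)) (r : ℕ) :
    Set (EuclideanSpace ℝ (Fin n)) :=
  {x | {ℓ | ∃ j ∈ G ℓ, x j ≠ 0}.ncard ≤ r}

/-- The `n₁ × n₂` matrices of rank at most `s`. Matrices are identified with vectors indexed by
the entries, so that the Euclidean norm is the Frobenius norm. -/
def lowRankSet (s n₁ n₂ : ℕ) : Set (EuclideanSpace ℝ (Fin n₁ × Fin n₂)) :=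
  {X | (Matrix.of fun i j => X (i, j)).rank ≤ s}

/-- The norm `‖x‖₁ = ∑ |xⱼ|`. -/
def l1norm {n : ℕ} (x : EuclideanSpace ℝ (Fin n)) : ℝ := ∑ j, |x j|

/-- The ball `{x : ‖x‖₁ ≤ r}`. -/
def l1Ball (r : ℝ) (n : ℕ) : Set (EuclideanSpace ℝ (Fin n)) := {x | l1norm x ≤ r}

end

/-! ### Gaussian width of a finite union of subspaces -/

section Projection

variable {E : Type*} [NormedAddCommGroup E] [InnerProductSpace ℝ E] [FiniteDimensional ℝ E]
  [MeasurableSpace E] [BorelSpace E]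

/-! Two mechanisms give all five bounds. Differences of two structured signals have doubled
structure, and this survives scaling.

For sparse, fused and group-sparse signals, the spherical tangent set lies in a union of `N`
subspaces of dimension at most `k`, one for each choice of `2s` positions, so the width is at most
`E max ‖P_i g‖`. `gaussianWidth_le_of_subset_iUnion_subspace` bounds this by `√k + √(2 log N)`: a
tangent-line inequality for `exp` turns the maximum into a sum of exponential moments of `‖P_i g‖²`,
which are explicit. With `N = C(m, 2s) ≤ (em/2s)^(2s)` this is sharper than what is claimed; the
slack `√(π/2)` is needed only for the one extra dimension of piecewise constant signals.

For low rank, a tangent matrix has rank at most `2s` and Frobenius norm one, so its pairing with `g`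
is at most `√(2s)` times the operator norm of `g`. The mean operator norm is at most `√n₁ + √n₂` by
Chevet's comparison, `lintegral_iSup_inner_outerVec_le`. It rests on `sudakov_fernique`, obtained
from Gaussian integration by parts along an interpolation between two families.

For the `ℓ₁` ball, tangent vectors satisfy `‖v‖₁ ≤ 2√s`. Splitting the coordinates of `g` into the
`2s` largest and the rest compares `⟨g, v⟩` pointwise with the supremum over sparse unit vectors. -/

theorem stdGaussian_map_orthogonalProjection (V : Submodule ℝ E) :
    (stdGaussian E).map V.orthogonalProjectionOnto = stdGaussian V := by
  apply Measure.ext_of_charFun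
  ext t
  have h : charFun ((stdGaussian E).map V.orthogonalProjectionOnto) t
      = charFun (stdGaussian E) (t : E) := by
    rw [charFun_apply, charFun_apply, integral_map (by fun_prop) (by fun_prop)]
    congr 1
    ext x
    rw [← Submodule.inner_orthogonalProjectionOnto_eq_of_mem_right]
  rw [h, charFun_stdGaussian, charFun_stdGaussian, Submodule.coe_norm]

theorem integrable_exp_sq_gaussianReal {μ : ℝ} (hμ : μ < 1 / 2) :
    Integrable (fun x : ℝ => Real.exp (μ * x ^ 2)) (gaussianReal 0 1) := by
  rw [gaussianReal_of_var_ne_zero 0 one_ne_zero,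
    integrable_withDensity_iff_integrable_smul₀' (by fun_prop)
      (ae_of_all _ fun _ => gaussianPDF_lt_top)]
  have h := (integrable_exp_neg_mul_sq (b := 1 / 2 - μ) (by linarith)).const_mul (√(2 * Real.pi))⁻¹
  refine h.congr (ae_of_all _ fun x => ?_)
  beta_reduce
  rw [toReal_gaussianPDF, gaussianPDFReal_def]
  simp only [smul_eq_mul, NNReal.coe_one, mul_one, sub_zero, mul_assoc, ← Real.exp_add]
  congr 2
  ring

theorem integral_exp_sq_gaussianReal {μ : ℝ} (hμ : μ < 1 / 2) :
    ∫ x, Real.exp (μ * x ^ 2) ∂(gaussianReal 0 1) = (√(1 - 2 * μ))⁻¹ := by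
  rw [integral_gaussianReal_eq_integral_smul one_ne_zero]
  have h : ∀ x : ℝ, gaussianPDFReal 0 1 x • Real.exp (μ * x ^ 2)
      = (√(2 * Real.pi))⁻¹ * Real.exp (-(1 / 2 - μ) * x ^ 2) := fun x => by
    simp only [gaussianPDFReal_def, smul_eq_mul, NNReal.coe_one, mul_one, sub_zero, mul_assoc,
      ← Real.exp_add]
    congr 2
    ring
  simp_rw [h]
  rw [integral_const_mul, integral_gaussian, ← Real.sqrt_inv, ← Real.sqrt_inv,
    ← Real.sqrt_mul (by positivity)]
  congr 1
  have : 1 - 2 * μ ≠ 0 := by linarith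
  have : 1 / 2 - μ ≠ 0 := by linarith
  field_simp

/-- In an orthonormal basis the squared norm is a sum of independent squares, so the moment factors
over coordinates. -/
theorem exp_norm_sq_stdGaussian {μ : ℝ} (hμ : μ < 1 / 2) :
    Integrable (fun x : E => Real.exp (μ * ‖x‖ ^ 2)) (stdGaussian E) ∧
      ∫ x : E, Real.exp (μ * ‖x‖ ^ 2) ∂(stdGaussian E)
        = (√(1 - 2 * μ))⁻¹ ^ Module.finrank ℝ E := by
  have hm : AEMeasurable (fun x : Fin (Module.finrank ℝ E) → ℝ =>
      ∑ i, x i • stdOrthonormalBasis ℝ E i)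
      (Measure.pi (fun _ : Fin (Module.finrank ℝ E) => gaussianReal 0 1)) :=
    Measurable.aemeasurable (by fun_prop)
  have h : ∀ x : Fin (Module.finrank ℝ E) → ℝ,
      Real.exp (μ * ‖∑ i, x i • stdOrthonormalBasis ℝ E i‖ ^ 2)
        = ∏ i, Real.exp (μ * x i ^ 2) := fun x => by
    rw [← Real.exp_sum, ← Finset.mul_sum, ← (stdOrthonormalBasis ℝ E).sum_sq_inner_right]
    congr! 4 with i
    simp [inner_sum, inner_smul_right, OrthonormalBasis.inner_eq_ite]
  rw [stdGaussian]
  constructor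
  · rw [integrable_map_measure (by fun_prop) hm]
    refine (Integrable.fintype_prod (f := fun _ x => Real.exp (μ * x ^ 2))
      fun _ => integrable_exp_sq_gaussianReal hμ).congr (ae_of_all _ fun x => ?_)
    simp only [Function.comp_apply]
    rw [h]
  · rw [integral_map hm (by fun_prop)]
    simp_rw [h]
    rw [integral_fintype_prod_eq_prod (f := fun _ x => Real.exp (μ * x ^ 2))]
    simp [integral_exp_sq_gaussianReal hμ]

theorem exp_norm_sq_orthogonalProjection {μ : ℝ} (hμ : μ < 1 / 2) (V : Submodule ℝ E) :
    Integrable (fun x : E => Real.exp (μ * ‖V.orthogonalProjectionOnto x‖ ^ 2)) (stdGaussian E) ∧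
      ∫ x : E, Real.exp (μ * ‖V.orthogonalProjectionOnto x‖ ^ 2) ∂(stdGaussian E)
        = (√(1 - 2 * μ))⁻¹ ^ Module.finrank ℝ V := by
  obtain ⟨h1, h2⟩ := exp_norm_sq_stdGaussian (E := V) hμ
  rw [← stdGaussian_map_orthogonalProjection] at h1 h2
  constructor
  · exact h1.comp_measurable (by fun_prop)
  · rw [← h2, integral_map (by fun_prop) (by fun_prop)]

/-- After `1 + x ≤ exp x`, the difference of the two sides is the square `(r - (a + b))² / (2(a +
b))`. Equality holds at `r = a + b`, the level the expected maximum should not exceed. -/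
theorem norm_le_add_exp {a b r : ℝ} (ha : 0 ≤ a) (hb : 0 < b) :
    r ≤ a + b - 1 / b +
      1 / b * Real.exp (b / (2 * (a + b)) * r ^ 2 - b * (a + b) / 2) := by
  have hab : 0 < a + b := by linarith
  have h := Real.add_one_le_exp (b / (2 * (a + b)) * r ^ 2 - b * (a + b) / 2)
  have h2 : 1 / b * (b / (2 * (a + b)) * r ^ 2 - b * (a + b) / 2 + 1)
      ≤ 1 / b * Real.exp (b / (2 * (a + b)) * r ^ 2 - b * (a + b) / 2) := by gcongr
  have h3 : 1 / b * (b / (2 * (a + b)) * r ^ 2 - b * (a + b) / 2 + 1)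
      = r - (a + b) + 1 / b + (r - (a + b)) ^ 2 / (2 * (a + b)) := by
    field_simp
    ring
  have h4 : 0 ≤ (r - (a + b)) ^ 2 / (2 * (a + b)) := by positivity
  linarith

/-- On `V i`, `|⟨g, v⟩| ≤ ‖P_i g‖`. Summing the exponential terms of `norm_le_add_exp` over `i`
majorises every `‖P_i g‖` at once by `R`. Each such term has mean at most `exp(-b²/2) / b`, so the
sum has mean at most `1 / b`, which cancels the `-1 / b`. -/
theorem gaussianWidth_le_of_subset_iUnion_subspace {ι : Type*} [Fintype ι]
    (V : ι → Submodule ℝ E) {K : Set E} (hK : ∀ v ∈ K, ‖v‖ ≤ 1 ∧ ∃ i, v ∈ V i) {k : ℕ}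
    (hk : 1 ≤ k) (hV : ∀ i, Module.finrank ℝ (V i) ≤ k) {b : ℝ} (hb : 0 < b)
    (hι : (Fintype.card ι : ℝ) ≤ Real.exp (b ^ 2 / 2)) :
    gaussianWidth K ≤ ENNReal.ofReal (√k + b) := by
  have hk' : (0 : ℝ) < k := by exact_mod_cast hk
  set a := √(k : ℝ) with ha
  have ha0 : 0 < a := Real.sqrt_pos.2 hk'
  have ha2 : a ^ 2 = k := Real.sq_sqrt hk'.le
  set μ := b / (2 * (a + b)) with hμ
  have hμ2 : 1 - 2 * μ = a / (a + b) := by rw [hμ]; field_simp; ring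
  have hμ' : μ < 1 / 2 := by
    have : 0 < a / (a + b) := by positivity
    linarith
  have hmgf : ∀ i, ∫ x : E, Real.exp (μ * ‖(V i).orthogonalProjectionOnto x‖ ^ 2) ∂(stdGaussian E)
      ≤ Real.exp (a * b / 2) := fun i => by
    rw [(exp_norm_sq_orthogonalProjection hμ' (V i)).2, hμ2, ← Real.sqrt_inv]
    -- The base is at least one, so the dimension may be raised to `k = a²`; then `1 + b/a ≤ exp
    -- (b/a)`.
    have h1 : 1 ≤ √(a / (a + b))⁻¹ := by
      rw [Real.one_le_sqrt, inv_div, one_le_div ha0]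
      linarith
    refine (pow_le_pow_right₀ h1 (hV i)).trans ?_
    have h2 : √(a / (a + b))⁻¹ ≤ Real.exp (b / (2 * a)) := by
      rw [Real.sqrt_le_left (Real.exp_pos _).le, ← Real.exp_nat_mul, inv_div]
      have := Real.add_one_le_exp (b / a)
      have e1 : (a + b) / a = b / a + 1 := by field_simp; ring
      have e2 : ((2 : ℕ) : ℝ) * (b / (2 * a)) = b / a := by push_cast; field_simp
      rw [e1, e2]
      exact this
    refine (pow_le_pow_left₀ (Real.sqrt_nonneg _) h2 _).trans ?_
    rw [← Real.exp_nat_mul, ← ha2]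
    apply le_of_eq
    congr 1
    field_simp
  let R : E → ℝ := fun x => a + b - 1 / b + ∑ i, 1 / b *
    Real.exp (μ * ‖(V i).orthogonalProjectionOnto x‖ ^ 2 - b * (a + b) / 2)
  have hRi : ∀ i, Integrable (fun x => 1 / b *
      Real.exp (μ * ‖(V i).orthogonalProjectionOnto x‖ ^ 2 - b * (a + b) / 2)) (stdGaussian E) := by
    intro i
    simp_rw [Real.exp_sub]
    exact ((exp_norm_sq_orthogonalProjection hμ' (V i)).1.div_const _).const_mul _
  have hRint : Integrable R (stdGaussian E) :=
    (integrable_const _).add (integrable_finsetSum _ fun i _ => hRi i)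
  have hRle : ∫ x, R x ∂(stdGaussian E) ≤ a + b := by
    rw [integral_add (integrable_const _) (integrable_finsetSum _ fun i _ => hRi i),
      integral_finsetSum _ fun i _ => hRi i]
    have h3 : ∀ i, ∫ x : E, 1 / b * Real.exp
        (μ * ‖(V i).orthogonalProjectionOnto x‖ ^ 2 - b * (a + b) / 2) ∂(stdGaussian E)
        ≤ 1 / b * Real.exp (-(b ^ 2 / 2)) := fun i => by
      simp_rw [Real.exp_sub]
      rw [integral_const_mul, integral_div]
      gcongr
      rw [div_le_iff₀ (Real.exp_pos _), ← Real.exp_add]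
      refine (hmgf i).trans (le_of_eq ?_)
      congr 1
      ring
    have h4 := Finset.sum_le_sum fun i (_ : i ∈ Finset.univ) => h3 i
    rw [Finset.sum_const, Finset.card_univ, nsmul_eq_mul] at h4
    have h5 : (Fintype.card ι : ℝ) * (1 / b * Real.exp (-(b ^ 2 / 2))) ≤ 1 / b := by
      calc _ ≤ Real.exp (b ^ 2 / 2) * (1 / b * Real.exp (-(b ^ 2 / 2))) := by gcongr
        _ = 1 / b := by rw [Real.exp_neg]; field_simp
    simp
    simp at h4 h5
    linarith
  have hle : ∀ i x, ‖(V i).orthogonalProjectionOnto x‖ ≤ R x := fun i x => by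
    refine (norm_le_add_exp ha0.le hb).trans ?_
    simp only [R]
    gcongr
    exact Finset.single_le_sum (f := fun i => 1 / b *
      Real.exp (μ * ‖(V i).orthogonalProjectionOnto x‖ ^ 2 - b * (a + b) / 2))
      (fun j _ => by positivity) (Finset.mem_univ i)
  -- Nonnegativity of `R` is read off from one index, so the empty family is treated apart.
  rcases isEmpty_or_nonempty ι with hι0 | ⟨⟨i₀⟩⟩
  · have : K = ∅ := Set.eq_empty_of_forall_notMem fun v hv => hι0.elim (hK v hv).2.choose
    simp [this, gaussianWidth]
  calc gaussianWidth K ≤ ∫⁻ x, ENNReal.ofReal (R x) ∂(stdGaussian E) := by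
        refine lintegral_mono fun x => iSup₂_le fun v hv => ENNReal.ofReal_le_ofReal ?_
        obtain ⟨hv1, i, hvi⟩ := hK v hv
        refine le_trans ?_ (hle i x)
        have h := abs_real_inner_le_norm ((V i).orthogonalProjectionOnto x) ⟨v, hvi⟩
        rw [Submodule.inner_orthogonalProjectionOnto_eq_of_mem_right] at h
        exact h.trans (mul_le_of_le_one_right (norm_nonneg _) hv1)
    _ = ENNReal.ofReal (∫ x, R x ∂(stdGaussian E)) :=
        (ofReal_integral_eq_lintegral_ofReal hRint
          (ae_of_all _ fun x => (norm_nonneg _).trans (hle i₀ x))).symm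
    _ ≤ ENNReal.ofReal (a + b) := ENNReal.ofReal_le_ofReal hRle

end Projection

/-! ### Counting supports and comparing constants -/

theorem choose_le_exp {n k : ℕ} (hk : 1 ≤ k) (hkn : k ≤ n) :
    (n.choose k : ℝ) ≤ Real.exp (k * Real.log (Real.exp 1 * n / k)) := by
  have hk' : (0 : ℝ) < k := by exact_mod_cast hk
  have hn' : (0 : ℝ) < n := by exact_mod_cast hk.trans hkn
  have h1 : (n.choose k : ℝ) ≤ n ^ k / k.factorial := Nat.choose_le_pow_div k n
  have h2 : (k : ℝ) ^ k / k.factorial ≤ Real.exp k := Real.pow_div_factorial_le_exp _ hk'.le k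
  rw [Real.exp_nat_mul, Real.exp_log (by positivity), div_pow, mul_pow, ← Real.exp_nat_mul, mul_one]
  refine h1.trans ?_
  rw [div_le_iff₀ (by positivity)] at h2
  rw [div_le_div_iff₀ (by positivity) (by positivity)]
  nlinarith [mul_le_mul_of_nonneg_left h2 (pow_nonneg hn'.le k)]

theorem one_le_log_exp_mul_div {n k : ℕ} (hk : 1 ≤ k) (hkn : k ≤ n) :
    1 ≤ Real.log (Real.exp 1 * n / k) := by
  have hk' : (0 : ℝ) < k := by exact_mod_cast hk
  have hkn' : (k : ℝ) ≤ n := by exact_mod_cast hkn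
  rw [Real.le_log_iff_exp_le (by have := hk'.trans_le hkn'; positivity), le_div_iff₀ hk']
  gcongr

/-- The logarithm is at least one, so each summand is a multiple of the same root, with factors `1`,
`1.42 ≥ √2` and `1`; their sum is below `3.5`. -/
theorem sqrt_add_sqrt_log_le {n s : ℕ} (hs : 1 ≤ s) (hsn : 2 * s ≤ n) :
    √(2 * s) + √(4 * s * Real.log (Real.exp 1 * n / (2 * s))) + √(Real.pi / 2)
      ≤ 3.5 * √(2 * s * Real.log (Real.exp 1 * n / (2 * s))) := by
  have hl := one_le_log_exp_mul_div (n := n) (k := 2 * s) (by omega) hsn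
  push_cast at hl
  set l := Real.log (Real.exp 1 * n / (2 * s))
  have hs' : (1 : ℝ) ≤ s := by exact_mod_cast hs
  have h1 : √(2 * s) ≤ √(2 * s * l) := Real.sqrt_le_sqrt (by nlinarith)
  have h2 : √(4 * s * l) ≤ 1.42 * √(2 * s * l) := by
    rw [Real.sqrt_le_left (by positivity), mul_pow, Real.sq_sqrt (by positivity)]
    nlinarith
  have h3 : √(Real.pi / 2) ≤ 1 * √(2 * s * l) := by
    rw [Real.sqrt_le_left (by positivity), mul_pow, Real.sq_sqrt (by positivity)]
    nlinarith [Real.pi_lt_four]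
  have := Real.sqrt_nonneg (2 * s * l)
  linarith

/-- A union of `C(m, 2s)` subspaces of dimension at most `k`. -/
theorem gaussianWidth_le_of_powersetCard {E : Type*} [NormedAddCommGroup E] [InnerProductSpace ℝ E]
    [FiniteDimensional ℝ E] [MeasurableSpace E] [BorelSpace E] {m s k : ℕ} (hs : 1 ≤ s)
    (hsm : 2 * s ≤ m) (hk : 1 ≤ k) (V : Finset (Fin m) → Submodule ℝ E)
    (hV : ∀ T, T.card = 2 * s → Module.finrank ℝ (V T) ≤ k) {K : Set E}
    (hK : ∀ v ∈ K, ‖v‖ ≤ 1 ∧ ∃ T, T.card = 2 * s ∧ v ∈ V T) :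
    gaussianWidth K ≤ ENNReal.ofReal
      (√k + √(4 * s * Real.log (Real.exp 1 * m / (2 * s)))) := by
  have hl := one_le_log_exp_mul_div (n := m) (k := 2 * s) (by omega) hsm
  have hc := choose_le_exp (n := m) (k := 2 * s) (by omega) hsm
  push_cast at hl hc
  have hs' : (1 : ℝ) ≤ s := by exact_mod_cast hs
  refine gaussianWidth_le_of_subset_iUnion_subspace
    (ι := Finset.powersetCard (2 * s) (Finset.univ : Finset (Fin m))) (fun T => V T)
    (fun v hv => ?_) hk (fun T => hV T (Finset.mem_powersetCard.1 T.2).2) (by positivity) ?_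
  · obtain ⟨h1, T, hT, hvT⟩ := hK v hv
    exact ⟨h1, ⟨T, Finset.mem_powersetCard.2 ⟨Finset.subset_univ _, hT⟩⟩, hvT⟩
  · rw [Fintype.card_coe, Finset.card_powersetCard, Finset.card_univ, Fintype.card_fin,
      Real.sq_sqrt (by positivity)]
    convert hc using 2
    ring

/-! ### Sparse signals -/

/-- The vectors supported on `T`. -/
def supportedSubspace {n : ℕ} (T : Finset (Fin n)) : Submodule ℝ (EuclideanSpace ℝ (Fin n)) where
  carrier := {x | ∀ j ∉ T, x j = 0}
  add_mem' := fun {x y} hx hy j hj => by simp [hx j hj, hy j hj]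
  zero_mem' := fun j _ => by simp
  smul_mem' := fun c x hx j hj => by simp [hx j hj]

theorem finrank_supportedSubspace_le {n : ℕ} (T : Finset (Fin n)) :
    Module.finrank ℝ (supportedSubspace T) ≤ T.card := by
  let f : supportedSubspace T →ₗ[ℝ] (T → ℝ) :=
    { toFun := fun x j => x.1 j
      map_add' := fun x y => by ext; simp
      map_smul' := fun c x => by ext; simp }
  have hf : Function.Injective f := by
    rw [← LinearMap.ker_eq_bot, LinearMap.ker_eq_bot']
    intro x hx
    ext j
    by_cases hj : j ∈ T
    · exact congrFun hx ⟨j, hj⟩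
    · exact x.2 j hj
  simpa using LinearMap.finrank_le_finrank_of_injective hf

theorem exists_card_eq_of_ncard_le {m k : ℕ} (hk : k ≤ m) {A : Set (Fin m)} (hA : A.ncard ≤ k) :
    ∃ T : Finset (Fin m), T.card = k ∧ A ⊆ T := by
  classical
  obtain ⟨T, h1, -, h2⟩ := Finset.exists_subsuperset_card_eq (s := A.toFinset)
    (t := Finset.univ) (n := k) (Finset.subset_univ _)
    (by rwa [← Set.ncard_eq_toFinset_card']) (by simpa using hk)
  exact ⟨T, h2, by simpa using h1⟩

theorem l0norm_sub_le {n : ℕ} (x y : EuclideanSpace ℝ (Fin n)) :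
    l0norm (x - y) ≤ l0norm x + l0norm y := by
  refine (Set.ncard_le_ncard ?_ (Set.toFinite _)).trans (Set.ncard_union_le _ _)
  intro j hj
  by_contra h
  simp only [Set.mem_union, Set.mem_ofPred_eq, not_or, not_not] at h
  exact hj (by simp [h.1, h.2])

theorem gaussianWidth_mono {E : Type*} [NormedAddCommGroup E] [InnerProductSpace ℝ E]
    [FiniteDimensional ℝ E] [MeasurableSpace E] [BorelSpace E] {K K' : Set E} (h : K ⊆ K') :
    gaussianWidth K ≤ gaussianWidth K' :=
  lintegral_mono fun _ => biSup_mono h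

theorem sphericalTangent_sparseSet_subset {n s : ℕ} {xu : EuclideanSpace ℝ (Fin n)}
    (hxu : xu ∈ sparseSet s n) :
    sphericalTangent (sparseSet s n) xu ⊆ sparseSet (2 * s) n ∩ Metric.sphere 0 1 := by
  rintro v ⟨⟨α, -, x, hx, rfl⟩, hv⟩
  refine ⟨?_, hv⟩
  have h1 : l0norm (α • (x - xu)) ≤ l0norm (x - xu) := by
    refine Set.ncard_le_ncard (fun j hj h => hj ?_) (Set.toFinite _)
    rw [PiLp.smul_apply, h, smul_zero]
  have h2 := l0norm_sub_le x xu
  have h3 : l0norm x ≤ s := hx.1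
  have h4 : l0norm xu ≤ s := hxu
  change l0norm _ ≤ _
  omega

theorem gaussianWidth_sparseSet_le {n s : ℕ} (hs : 1 ≤ s) (hsn : 2 * s ≤ n) :
    gaussianWidth (sparseSet (2 * s) n ∩ Metric.sphere 0 1)
      ≤ ENNReal.ofReal (√(2 * s) + √(4 * s * Real.log (Real.exp 1 * n / (2 * s)))) := by
  have := gaussianWidth_le_of_powersetCard hs hsn (k := 2 * s) (by omega) supportedSubspace
    (fun T hT => (finrank_supportedSubspace_le T).trans hT.le)
    (K := sparseSet (2 * s) n ∩ Metric.sphere 0 1) (fun v hv => ⟨by simpa using hv.2.le, ?_⟩)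
  · simpa using this
  · obtain ⟨T, hT, hvT⟩ := exists_card_eq_of_ncard_le hsn hv.1
    exact ⟨T, hT, fun j hj => by_contra fun h => hj (hvT h)⟩

/-! ### Piecewise constant signals -/

/-- The vectors whose jumps are at positions in `T`. -/
def jumpSubspace {n : ℕ} (T : Finset (Fin n)) : Submodule ℝ (EuclideanSpace ℝ (Fin n)) where
  carrier := {x | ∀ i : Fin (n - 1), (⟨i.1, by omega⟩ : Fin n) ∉ T → firstDiff x i = 0}
  add_mem' := fun {x y} hx hy j hj => by
    have h1 := hx j hj
    have h2 := hy j hj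
    simp only [firstDiff, PiLp.add_apply] at h1 h2 ⊢
    linarith
  zero_mem' := fun j _ => by simp [firstDiff]
  smul_mem' := fun c x hx j hj => by
    have h1 := hx j hj
    simp only [firstDiff, PiLp.smul_apply, smul_eq_mul] at h1 ⊢
    rw [← mul_sub, h1, mul_zero]

/-- A signal is determined by its first value, which costs the extra dimension, and its jumps. The
last index of `Fin n` carries no jump, so its coordinate is set to `0`. -/
theorem finrank_jumpSubspace_le {n : ℕ} (hn : 0 < n) (T : Finset (Fin n)) :
    Module.finrank ℝ (jumpSubspace T) ≤ T.card + 1 := by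
  let f : jumpSubspace T →ₗ[ℝ] (T → ℝ) × ℝ :=
    { toFun := fun x => (fun j => if h : j.1.1 + 1 < n then x.1 ⟨j.1.1 + 1, h⟩ - x.1 j.1 else 0,
        x.1 ⟨0, hn⟩)
      map_add' := fun x y => by
        ext j
        · simp only [Submodule.coe_add, PiLp.add_apply, Prod.mk_add_mk, Pi.add_apply]
          split_ifs <;> ring
        · simp
      map_smul' := fun c x => by
        ext j
        · simp only [Submodule.coe_smul, PiLp.smul_apply, Prod.smul_mk, Pi.smul_apply,
            smul_eq_mul, RingHom.id_apply]
          split_ifs <;> ring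
        · simp }
  have hf : Function.Injective f := by
    rw [← LinearMap.ker_eq_bot, LinearMap.ker_eq_bot']
    intro x hx
    have h0 : x.1 ⟨0, hn⟩ = 0 := congrArg Prod.snd hx
    have hstep : ∀ i (hi : i + 1 < n), x.1 ⟨i + 1, hi⟩ - x.1 ⟨i, by omega⟩ = 0 := by
      intro i hi
      by_cases hT : (⟨i, by omega⟩ : Fin n) ∈ T
      · have := congrFun (congrArg Prod.fst hx) ⟨_, hT⟩
        simpa [f, hi] using this
      · exact x.2 ⟨i, by omega⟩ hT
    have hall : ∀ i (hi : i < n), x.1 ⟨i, hi⟩ = 0 := by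
      intro i
      induction i with
      | zero => exact fun _ => h0
      | succ i ih =>
        intro hi
        have := hstep i hi
        rw [ih (by omega)] at this
        simpa using this
    ext j
    exact hall j.1 j.2
  simpa using LinearMap.finrank_le_finrank_of_injective hf

theorem gaussianWidth_piecewiseConstantSet_le {n s : ℕ} (hs : 1 ≤ s) (hsn : 2 * s ≤ n)
    {xu : EuclideanSpace ℝ (Fin n)} (hxu : xu ∈ piecewiseConstantSet s n) :
    gaussianWidth (sphericalTangent (piecewiseConstantSet s n) xu)
      ≤ ENNReal.ofReal (√(2 * s) + √(4 * s * Real.log (Real.exp 1 * n / (2 * s)))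
          + √(Real.pi / 2)) := by
  have key := gaussianWidth_le_of_powersetCard hs hsn (k := 2 * s + 1) (by omega) jumpSubspace
    (fun T hT => (finrank_jumpSubspace_le (by omega) T).trans (by omega))
    (K := sphericalTangent (piecewiseConstantSet s n) xu) (fun v hv => ⟨by simpa using hv.2.le, ?_⟩)
  · refine key.trans (ENNReal.ofReal_le_ofReal ?_)
    -- The extra dimension is absorbed because `1 ≤ π / 2`.
    have h1 : √((2 * s + 1 : ℕ) : ℝ) ≤ √(2 * s) + √(Real.pi / 2) := by
      rw [Real.sqrt_le_left (by positivity), add_sq, Real.sq_sqrt (by positivity),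
        Real.sq_sqrt (by positivity)]
      push_cast
      have := Real.pi_gt_three
      have : 0 ≤ 2 * √(2 * s) * √(Real.pi / 2) := by positivity
      linarith
    linarith
  · obtain ⟨⟨α, -, x, hx, rfl⟩, -⟩ := hv
    have h1 : firstDiff (x - xu) = firstDiff x - firstDiff xu := by
      ext i
      simp only [firstDiff, PiLp.sub_apply]
      ring
    have h2 := l0norm_sub_le (firstDiff x) (firstDiff xu)
    have h3 : l0norm (firstDiff x) ≤ s := hx.1
    have h4 : l0norm (firstDiff xu) ≤ s := hxu
    -- Placing jump positions in `Fin n` rather than `Fin (n - 1)` yields the count `C(n, 2s)` and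
    -- leaves room when `2s = n`.
    obtain ⟨T, hT, hvT⟩ := exists_card_eq_of_ncard_le hsn
      (A := (fun i : Fin (n - 1) => (⟨i.1, by omega⟩ : Fin n)) '' {i | firstDiff (x - xu) i ≠ 0})
      ((Set.ncard_image_le (Set.toFinite _)).trans (by
        change l0norm _ ≤ _
        rw [h1]
        omega))
    refine ⟨T, hT, Submodule.smul_mem _ _ fun i hi => by_contra fun h => hi (hvT ⟨i, h, rfl⟩)⟩

/-! ### Group-sparse signals -/

theorem gaussianWidth_groupSparseSet_le {n L s : ℕ} (G : Fin L → Finset (Fin n))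
    {xu : EuclideanSpace ℝ (Fin n)} (hG : ∀ j, ∃ l, j ∈ G l) (hs : 1 ≤ s) (hsL : 2 * s ≤ L)
    (hxu1 : ‖xu‖ = 1) (hxu : xu ∈ groupSparseSet G s) :
    gaussianWidth (sphericalTangent (groupSparseSet G s) xu)
      ≤ ENNReal.ofReal (√(2 * s * (Finset.univ.sup fun l => (G l).card : ℕ))
          + √(4 * s * Real.log (Real.exp 1 * L / (2 * s)))) := by
  classical
  set M := Finset.univ.sup fun l => (G l).card with hM
  have hle : ∀ l, (G l).card ≤ M := fun l =>
    Finset.le_sup (f := fun l => (G l).card) (Finset.mem_univ l)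
  -- A unit vector has a nonzero coordinate, and the group covering it is nonempty. This makes the
  -- dimension bound `2sM` positive.
  have hM1 : 1 ≤ M := by
    have : ∃ j, xu j ≠ 0 := by
      by_contra! h
      have : xu = 0 := by ext j; exact h j
      simp [this] at hxu1
    obtain ⟨j, -⟩ := this
    obtain ⟨l, hl⟩ := hG j
    exact (Finset.card_pos.2 ⟨j, hl⟩).trans_le (hle l)
  have key := gaussianWidth_le_of_powersetCard hs hsL (k := 2 * s * M)
    (Nat.mul_pos (by omega) hM1) (fun T => supportedSubspace (T.biUnion G))
    (fun T hT => (finrank_supportedSubspace_le _).trans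
      (hT ▸ Finset.card_biUnion_le_card_mul T G M fun l _ => hle l))
    (K := sphericalTangent (groupSparseSet G s) xu) (fun v hv => ⟨by simpa using hv.2.le, ?_⟩)
  · simpa using key
  · obtain ⟨⟨α, -, x, hx, rfl⟩, -⟩ := hv
    have h3 : {ℓ | ∃ j ∈ G ℓ, x j ≠ 0}.ncard ≤ s := hx.1
    have h4 : {ℓ | ∃ j ∈ G ℓ, xu j ≠ 0}.ncard ≤ s := hxu
    obtain ⟨T, hT, hvT⟩ := exists_card_eq_of_ncard_le hsL
      (A := {ℓ | ∃ j ∈ G ℓ, x j ≠ 0} ∪ {ℓ | ∃ j ∈ G ℓ, xu j ≠ 0})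
      ((Set.ncard_union_le _ _).trans (by omega))
    refine ⟨T, hT, Submodule.smul_mem _ _ fun j hj => ?_⟩
    obtain ⟨l, hl⟩ := hG j
    have hlT : l ∉ T := fun h => hj (Finset.mem_biUnion.2 ⟨l, h, hl⟩)
    have h5 : x j = 0 := by_contra fun h => hlT (hvT (Or.inl ⟨j, hl, h⟩))
    have h6 : xu j = 0 := by_contra fun h => hlT (hvT (Or.inr ⟨j, hl, h⟩))
    simp [h5, h6]

/-! ### The `ℓ₁`-ball constraint -/

theorem exists_card_eq_forall_le {n k : ℕ} (hk : k ≤ n) (f : Fin n → ℝ) :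
    ∃ T : Finset (Fin n), T.card = k ∧ ∀ i ∈ T, ∀ j ∉ T, f j ≤ f i := by
  classical
  induction k with
  | zero => exact ⟨∅, by simp⟩
  | succ k ih =>
    obtain ⟨T, hT, h⟩ := ih (by omega)
    have hne : Tᶜ.Nonempty := by
      rw [← Finset.card_pos, Finset.card_compl, Fintype.card_fin]
      omega
    obtain ⟨m, hm, hmax⟩ := Finset.exists_max_image Tᶜ f hne
    rw [Finset.mem_compl] at hm
    refine ⟨insert m T, by rw [Finset.card_insert_of_notMem hm, hT], fun i hi j hj => ?_⟩
    rw [Finset.mem_insert, not_or] at hj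
    rcases Finset.mem_insert.1 hi with rfl | hi
    · exact hmax j (Finset.mem_compl.2 hj.2)
    · exact h i hi j hj.2

/-- The witness is the restriction of `g` to `T`, normalised; when that restriction vanishes there
is nothing to prove. -/
theorem ofReal_sqrt_sum_sq_le_iSup {n k : ℕ} (g : EuclideanSpace ℝ (Fin n)) (T : Finset (Fin n))
    (hT : T.card ≤ k) :
    ENNReal.ofReal √(∑ j ∈ T, g j ^ 2)
      ≤ ⨆ v ∈ sparseSet k n ∩ Metric.sphere 0 1, ENNReal.ofReal |inner ℝ g v| := by
  classical
  set N := √(∑ j ∈ T, g j ^ 2) with hN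
  have hN2 : N ^ 2 = ∑ j ∈ T, g j ^ 2 := Real.sq_sqrt (Finset.sum_nonneg fun _ _ => sq_nonneg _)
  rcases (Real.sqrt_nonneg _ : 0 ≤ N).eq_or_lt with h0 | h0
  · rw [← hN] at h0
    simp [← h0]
  let v : EuclideanSpace ℝ (Fin n) := WithLp.toLp 2 fun j => if j ∈ T then g j / N else 0
  have hv1 : v ∈ sparseSet k n := by
    refine le_trans ?_ hT
    rw [← Set.ncard_coe_finset]
    refine Set.ncard_le_ncard (fun j hj => by_contra fun h => hj ?_) (Set.toFinite _)
    simp only [Finset.mem_coe] at h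
    simp [v, h]
  have hv2 : v ∈ Metric.sphere (0 : EuclideanSpace ℝ (Fin n)) 1 := by
    have : ‖v‖ ^ 2 = 1 := by
      rw [EuclideanSpace.real_norm_sq_eq]
      simp only [v, ite_pow, ne_eq, OfNat.ofNat_ne_zero, not_false_eq_true, zero_pow,
        Finset.sum_ite_mem, Finset.univ_inter, div_pow]
      rw [← Finset.sum_div, ← hN2, div_self (by positivity)]
    rw [mem_sphere_zero_iff_norm]
    exact (pow_eq_one_iff_of_nonneg (norm_nonneg v) two_ne_zero).1 this
  have hv3 : inner ℝ g v = N := by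
    rw [PiLp.inner_apply]
    simp only [v, RCLike.inner_apply, conj_trivial, ite_mul, zero_mul, Finset.sum_ite_mem,
      Finset.univ_inter]
    have : ∀ j, g j / N * g j = g j ^ 2 / N := fun j => by ring
    simp_rw [this]
    rw [← Finset.sum_div, ← hN2]
    field_simp
  refine le_trans (le_of_eq ?_) (le_iSup₂ v ⟨hv1, hv2⟩)
  rw [hv3, abs_of_pos h0]

/-- Let `N` be the norm of `g` on its `2s` largest coordinates. Cauchy–Schwarz gives `N` on `T`. Off
`T`, each `|g j|` is at most the root mean square `N / √(2s)` over `T`, and Hölder with `‖v‖₁ ≤ 2√s`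
gives `√2 N`. Finally `1 + √2 ≤ 2√2`. -/
theorem sum_abs_mul_abs_le {n s : ℕ} (hs : 1 ≤ s) (g v : EuclideanSpace ℝ (Fin n))
    (T : Finset (Fin n)) (hT : T.card = 2 * s) (hTg : ∀ i ∈ T, ∀ j ∉ T, |g j| ≤ |g i|)
    (hv : ‖v‖ ≤ 1) (hv1 : l1norm v ≤ 2 * √s) :
    |inner ℝ g v| ≤ 2 * √2 * √(∑ j ∈ T, g j ^ 2) := by
  classical
  have hs' : (0 : ℝ) < s := by exact_mod_cast hs
  set N := √(∑ j ∈ T, g j ^ 2) with hN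
  have hN0 : 0 ≤ N := Real.sqrt_nonneg _
  have hτ : ∀ j ∉ T, |g j| ≤ N / √(2 * s) := fun j hj => by
    rw [le_div_iff₀ (by positivity), hN]
    apply Real.le_sqrt_of_sq_le
    rw [mul_pow, Real.sq_sqrt (by positivity)]
    have := Finset.card_nsmul_le_sum T (fun i => g i ^ 2) (|g j| ^ 2) fun i hi =>
      (pow_le_pow_left₀ (abs_nonneg _) (hTg i hi j hj) 2).trans_eq (sq_abs _)
    rw [hT, nsmul_eq_mul] at this
    push_cast at this
    linarith
  have h1 : ∑ j ∈ T, |g j| * |v j| ≤ N := by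
    refine (Real.sum_mul_le_sqrt_mul_sqrt T _ _).trans ?_
    simp only [sq_abs]
    refine mul_le_of_le_one_right hN0 (Real.sqrt_le_one.2 ?_)
    calc ∑ j ∈ T, v j ^ 2 ≤ ∑ j, v j ^ 2 :=
          Finset.sum_le_sum_of_subset_of_nonneg (Finset.subset_univ _) fun _ _ _ => sq_nonneg _
      _ = ‖v‖ ^ 2 := (EuclideanSpace.real_norm_sq_eq v).symm
      _ ≤ 1 := pow_le_one₀ (norm_nonneg _) hv
  have h2 : ∑ j ∈ Tᶜ, |g j| * |v j| ≤ √2 * N := by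
    calc ∑ j ∈ Tᶜ, |g j| * |v j| ≤ ∑ j ∈ Tᶜ, N / √(2 * s) * |v j| := by
          gcongr with j hj
          exact hτ j (Finset.mem_compl.1 hj)
      _ ≤ ∑ j, N / √(2 * s) * |v j| :=
          Finset.sum_le_sum_of_subset_of_nonneg (Finset.subset_univ _) fun _ _ _ => by positivity
      _ = N / √(2 * s) * l1norm v := by rw [← Finset.mul_sum, l1norm]
      _ ≤ N / √(2 * s) * (2 * √s) := by gcongr
      _ = √2 * N := by
          rw [Real.sqrt_mul (by norm_num)]
          field_simp
          rw [Real.sq_sqrt (by norm_num)]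
  have h3 : |inner ℝ g v| ≤ ∑ j, |g j| * |v j| := by
    rw [PiLp.inner_apply]
    refine (Finset.abs_sum_le_sum_abs _ _).trans (le_of_eq (Finset.sum_congr rfl fun j _ => ?_))
    simp [abs_mul, mul_comm]
  rw [← Finset.sum_add_sum_compl T] at h3
  have h4 : 1 ≤ √2 := Real.one_le_sqrt.2 (by norm_num)
  nlinarith

/-- The descent cone condition: since `‖x‖₁ ≤ ‖xu‖₁`, the mass of `x - xu` off the support `S` of
`xu` is at most its mass on `S`. Cauchy–Schwarz on `S` then costs `√s`. -/
theorem l1norm_le_of_mem_sphericalTangent {n s : ℕ} {xu : EuclideanSpace ℝ (Fin n)}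
    (hxu : xu ∈ sparseSet s n) {v : EuclideanSpace ℝ (Fin n)}
    (hv : v ∈ sphericalTangent (l1Ball (l1norm xu) n) xu) : l1norm v ≤ 2 * √s := by
  classical
  obtain ⟨⟨α, hα, x, hx, rfl⟩, hv⟩ := hv
  rw [mem_sphere_zero_iff_norm] at hv
  have hx : l1norm x ≤ l1norm xu := hx.1
  set S : Finset (Fin n) := {j | xu j ≠ 0} with hS
  have hScard : S.card ≤ s := by
    have h : l0norm xu ≤ s := hxu
    rwa [l0norm, Set.ncard_eq_toFinset_card', Set.toFinset_ofPred] at h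
  have hdiff : l1norm (x - xu) ≤ 2 * ∑ j ∈ S, |(x - xu) j| := by
    have hxuS : l1norm xu = ∑ j ∈ S, |xu j| := by
      rw [l1norm, ← Finset.sum_add_sum_compl S, add_eq_left]
      refine Finset.sum_eq_zero fun j hj => ?_
      simpa [hS] using hj
    have hc : ∑ j ∈ Sᶜ, |(x - xu) j| = ∑ j ∈ Sᶜ, |x j| := by
      refine Finset.sum_congr rfl fun j hj => ?_
      have : xu j = 0 := by simpa [hS] using hj
      simp [this]
    have h1 : ∑ j ∈ S, |xu j| ≤ ∑ j ∈ S, |x j| + ∑ j ∈ S, |(x - xu) j| := by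
      rw [← Finset.sum_add_distrib]
      refine Finset.sum_le_sum fun j _ => ?_
      rw [PiLp.sub_apply, abs_sub_comm]
      have := abs_sub_abs_le_abs_sub (xu j) (x j)
      linarith
    have h2 : l1norm x = ∑ j ∈ S, |x j| + ∑ j ∈ Sᶜ, |x j| := by
      rw [l1norm, Finset.sum_add_sum_compl]
    have h3 : l1norm (x - xu) = ∑ j ∈ S, |(x - xu) j| + ∑ j ∈ Sᶜ, |(x - xu) j| := by
      rw [l1norm, Finset.sum_add_sum_compl]
    linarith
  set v := α • (x - xu) with hvdef
  have hvj : ∀ j, |v j| = α * |(x - xu) j| := fun j => by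
    rw [hvdef, PiLp.smul_apply, smul_eq_mul, abs_mul, abs_of_nonneg hα]
  have h1 : l1norm v ≤ 2 * ∑ j ∈ S, |v j| := by
    rw [l1norm]
    simp_rw [hvj]
    rw [← Finset.mul_sum, ← Finset.mul_sum]
    rw [l1norm] at hdiff
    nlinarith
  have h2 : ∑ j ∈ S, |v j| ≤ √s := by
    apply Real.le_sqrt_of_sq_le
    refine sq_sum_le_card_mul_sum_sq.trans ?_
    have h3 : ∑ j ∈ S, |v j| ^ 2 ≤ 1 := by
      calc ∑ j ∈ S, |v j| ^ 2 ≤ ∑ j, |v j| ^ 2 :=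
            Finset.sum_le_sum_of_subset_of_nonneg (Finset.subset_univ _) fun _ _ _ => sq_nonneg _
        _ = ‖v‖ ^ 2 := by simp [EuclideanSpace.real_norm_sq_eq]
        _ = 1 := by rw [hv, one_pow]
    have h4 : (S.card : ℝ) ≤ s := by exact_mod_cast hScard
    have : (0 : ℝ) ≤ S.card := Nat.cast_nonneg _
    nlinarith
  linarith

theorem one_le_of_mem_sparseSet {n s : ℕ} {xu : EuclideanSpace ℝ (Fin n)} (hxu1 : ‖xu‖ = 1)
    (hxu : xu ∈ sparseSet s n) : 1 ≤ s := by
  by_contra! h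
  have h0 : l0norm xu ≤ s := hxu
  have h1 : l0norm xu = 0 := by omega
  rw [l0norm, Set.ncard_eq_zero] at h1
  have : xu = 0 := by
    ext j
    by_contra hj
    exact (h1 ▸ hj : j ∈ (∅ : Set (Fin n)))
  simp [this] at hxu1

theorem gaussianWidth_l1Ball_le {n s : ℕ} {xu : EuclideanSpace ℝ (Fin n)} (hxu1 : ‖xu‖ = 1)
    (hxu : xu ∈ sparseSet s n) :
    gaussianWidth (sphericalTangent (l1Ball (l1norm xu) n) xu)
      ≤ ENNReal.ofReal (2 * √2) * gaussianWidth (sparseSet (2 * s) n ∩ Metric.sphere 0 1) := by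
  classical
  have h4 : 1 ≤ 2 * √2 := by
    have : 1 ≤ √2 := Real.one_le_sqrt.2 (by norm_num)
    linarith
  have hs := one_le_of_mem_sparseSet hxu1 hxu
  by_cases hsn : 2 * s ≤ n
  · rw [gaussianWidth, gaussianWidth, ← lintegral_const_mul' _ _ ENNReal.ofReal_ne_top]
    refine lintegral_mono fun g => iSup₂_le fun v hv => ?_
    obtain ⟨T, hT, hTg⟩ := exists_card_eq_forall_le hsn fun j => |g j|
    refine (ENNReal.ofReal_le_ofReal (sum_abs_mul_abs_le hs g v T hT hTg (by simpa using hv.2.le)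
      (l1norm_le_of_mem_sphericalTangent hxu hv))).trans ?_
    rw [ENNReal.ofReal_mul (by positivity)]
    gcongr
    exact ofReal_sqrt_sum_sq_le_iSup g T hT.le
  -- When `2s > n` every vector is `2s`-sparse, so inclusion suffices.
  · have hsub : sphericalTangent (l1Ball (l1norm xu) n) xu
        ⊆ sparseSet (2 * s) n ∩ Metric.sphere 0 1 := fun v hv => by
      refine ⟨?_, hv.2⟩
      have := Set.ncard_le_card {j | v j ≠ 0}
      rw [Nat.card_eq_fintype_card, Fintype.card_fin] at this
      change Set.ncard _ ≤ _
      omega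
    refine (gaussianWidth_mono hsub).trans (le_mul_of_one_le_left zero_le ?_)
    rwa [ENNReal.one_le_ofReal]

/-! ### Gaussian integration by parts -/

section Stein

/-- The Gaussian density `p` satisfies `p' = -x p`, so this is integration by parts on the line. -/
theorem integral_id_mul_gaussianReal {u u' : ℝ → ℝ} (hu : ∀ x, HasDerivAt u (u' x) x) {A B : ℝ}
    (hA : ∀ x, |u x| ≤ A) (hB : ∀ x, |u' x| ≤ B) :
    ∫ x, x * u x ∂(gaussianReal 0 1) = ∫ x, u' x ∂(gaussianReal 0 1) := by
  have hum : Continuous u := continuous_iff_continuousAt.2 fun x => (hu x).continuousAt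
  have hu'm : Measurable u' := by
    have : u' = deriv u := by ext x; exact (hu x).deriv.symm
    rw [this]
    exact measurable_deriv u
  have hp : ∀ x : ℝ, HasDerivAt (gaussianPDFReal 0 1) (-x * gaussianPDFReal 0 1 x) x := fun x => by
    have h : gaussianPDFReal 0 1 = fun x : ℝ => (√(2 * Real.pi))⁻¹ * Real.exp (-x ^ 2 / 2) := by
      ext x
      simp [gaussianPDFReal]
    rw [h]
    have h1 : HasDerivAt (fun x : ℝ => -x ^ 2 / 2) (-x) x := by
      refine (((hasDerivAt_id x).pow 2).neg.div_const 2).congr_deriv ?_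
      simp
      ring
    refine (h1.exp.const_mul _).congr_deriv ?_
    ring
  have hpi : Integrable (gaussianPDFReal 0 1) := integrable_gaussianPDFReal 0 1
  have hxi : Integrable (fun x : ℝ => -x * gaussianPDFReal 0 1 x) := by
    have h := (memLp_id_gaussianReal' (μ := 0) (v := 1) 1 ENNReal.one_ne_top).integrable le_rfl
    rw [gaussianReal_of_var_ne_zero 0 one_ne_zero, integrable_withDensity_iff_integrable_smul₀'
      (by fun_prop) (ae_of_all _ fun _ => gaussianPDF_lt_top)] at h
    refine h.neg.congr (ae_of_all _ fun x => ?_)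
    simp [toReal_gaussianPDF, mul_comm]
  have h1 : Integrable (u * fun x => -x * gaussianPDFReal 0 1 x) :=
    hxi.bdd_mul hum.aestronglyMeasurable (ae_of_all _ hA)
  have h2 : Integrable (u' * gaussianPDFReal 0 1) :=
    hpi.bdd_mul hu'm.aestronglyMeasurable (ae_of_all _ hB)
  have h3 : Integrable (u * gaussianPDFReal 0 1) :=
    hpi.bdd_mul hum.aestronglyMeasurable (ae_of_all _ hA)
  have := integral_mul_deriv_eq_deriv_mul_of_integrable (fun x _ => hu x) (fun x _ => hp x) h1 h2 h3
  rw [integral_gaussianReal_eq_integral_smul one_ne_zero,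
    integral_gaussianReal_eq_integral_smul one_ne_zero, ← neg_inj]
  simp only [smul_eq_mul]
  calc _ = ∫ x, u x * (-x * gaussianPDFReal 0 1 x) := by
        rw [← integral_neg]
        congr 1
        ext x
        ring
    _ = _ := by
        rw [this]
        congr 2
        ext x
        ring

variable {H : Type*} [NormedAddCommGroup H] [InnerProductSpace ℝ H] [FiniteDimensional ℝ H]
  [MeasurableSpace H] [BorelSpace H]

/-- The component of a standard Gaussian vector along a unit vector can be resampled. -/
theorem map_prod_stdGaussian {e : H} (he : ‖e‖ = 1) :
    ((gaussianReal 0 1).prod (stdGaussian H)).map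
      (fun p => p.2 + (p.1 - inner ℝ e p.2) • e) = stdGaussian H := by
  apply Measure.ext_of_charFun
  ext t
  rw [charFun_stdGaussian, charFun_apply, integral_map (by fun_prop) (by fun_prop)]
  -- The fresh coordinate sees only `⟨e, t⟩` and the old vector only the part of `t` orthogonal to
  -- `e`; by Pythagoras the two exponents recombine to `‖t‖²`.
  have h : ∀ p : ℝ × H,
      Complex.exp (inner ℝ (p.2 + (p.1 - inner ℝ e p.2) • e) t * Complex.I)
        = Complex.exp (inner ℝ p.1 (inner ℝ e t) * Complex.I)
          * Complex.exp (inner ℝ p.2 (t - inner ℝ e t • e) * Complex.I) := fun p => by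
    rw [← Complex.exp_add, ← add_mul, ← Complex.ofReal_add]
    congr 3
    simp only [inner_add_left, inner_smul_left, inner_sub_right, inner_smul_right,
      real_inner_comm, conj_trivial, RCLike.inner_apply]
    ring
  simp_rw [h]
  rw [integral_prod_mul (fun x : ℝ => Complex.exp (inner ℝ x (inner ℝ e t) * Complex.I))
    (fun y : H => Complex.exp (inner ℝ y (t - inner ℝ e t • e) * Complex.I)), ← charFun_apply,
    ← charFun_apply, charFun_stdGaussian, charFun_gaussianReal, ← Complex.exp_add]
  congr 1
  have h2 : ‖t - inner ℝ e t • e‖ ^ 2 = ‖t‖ ^ 2 - inner ℝ e t ^ 2 := by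
    rw [norm_sub_sq_real, inner_smul_right, norm_smul, he, real_inner_comm, mul_one,
      Real.norm_eq_abs, sq_abs]
    ring
  replace h2 := congrArg Complex.ofReal h2
  push_cast at h2
  rw [h2]
  push_cast
  ring

/-- Gaussian integration by parts. -/
theorem integral_inner_mul_stdGaussian (c : H) {φ ψ : H → ℝ}
    (hφ : ∀ x, HasDerivAt (fun t : ℝ => φ (x + t • c)) (ψ x) 0) (hφm : Measurable φ)
    (hψm : Measurable ψ) {A B : ℝ} (hA : ∀ x, |φ x| ≤ A) (hB : ∀ x, |ψ x| ≤ B) :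
    ∫ x, inner ℝ c x * φ x ∂(stdGaussian H) = ∫ x, ψ x ∂(stdGaussian H) := by
  rcases eq_or_ne c 0 with rfl | hc
  · have : ∀ x, ψ x = 0 := fun x => (hφ x).unique (by simpa using hasDerivAt_const (0 : ℝ) (φ x))
    simp [this]
  have hc0 : 0 < ‖c‖ := norm_pos_iff.2 hc
  set e := ‖c‖⁻¹ • c with hedef
  have he : ‖e‖ = 1 := norm_smul_inv_norm hc
  have hce : c = ‖c‖ • e := by rw [hedef, smul_smul, mul_inv_cancel₀ hc0.ne', one_smul]
  -- With the resampled coordinate as variable, the claim becomes the one-dimensional identity on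
  -- each line parallel to `c`.
  have hline : ∀ y (x : ℝ), HasDerivAt (fun x : ℝ => φ (y + (x - inner ℝ e y) • e))
      (‖c‖⁻¹ * ψ (y + (x - inner ℝ e y) • e)) x := fun y x => by
    have h1 := hφ (y + (x - inner ℝ e y) • e)
    have h2 : HasDerivAt (fun z : ℝ => ‖c‖⁻¹ * (z - x)) ‖c‖⁻¹ x := by
      simpa using ((hasDerivAt_id x).sub_const x).const_mul ‖c‖⁻¹
    have h3 : HasDerivAt (fun t : ℝ => φ (y + (x - inner ℝ e y) • e + t • c))
      (ψ (y + (x - inner ℝ e y) • e)) (‖c‖⁻¹ * (x - x)) := by simpa using h1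
    refine ((h3.comp x h2).congr_deriv (mul_comm _ _)).congr_of_eventuallyEq
      (Filter.Eventually.of_forall fun z => ?_)
    simp only [Function.comp_apply]
    congr 1
    rw [add_assoc, mul_comm, mul_smul, ← hedef, ← add_smul]
    congr 2
    ring
  have hint1 : Integrable (fun x => inner ℝ c x * φ x) (stdGaussian H) := by
    have h : Integrable (fun x : H => inner ℝ c x) (stdGaussian H) :=
      (IsGaussian.integrable_id (μ := stdGaussian H)).const_inner c
    exact h.mul_bdd hφm.aestronglyMeasurable (ae_of_all _ hA)
  have hint2 : Integrable ψ (stdGaussian H) :=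
    Integrable.of_bound hψm.aestronglyMeasurable B (ae_of_all _ hB)
  have hmap : Measurable fun p : ℝ × H => p.2 + (p.1 - inner ℝ e p.2) • e := by fun_prop
  have hpi1 := hint1
  have hpi2 := hint2
  rw [← map_prod_stdGaussian he] at hpi1 hpi2 ⊢
  have hs1 := integral_prod_symm _ (hpi1.comp_measurable hmap)
  have hs2 := integral_prod_symm _ (hpi2.comp_measurable hmap)
  simp only [Function.comp_apply] at hs1 hs2
  rw [integral_map hmap.aemeasurable hpi1.aestronglyMeasurable,
    integral_map hmap.aemeasurable hpi2.aestronglyMeasurable, hs1, hs2]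
  congr 1
  ext y
  have h := integral_id_mul_gaussianReal (hline y) (A := A) (B := ‖c‖⁻¹ * B) (fun x => hA _)
    (fun x => by
      rw [abs_mul, abs_of_pos (inv_pos.2 hc0)]
      exact mul_le_mul_of_nonneg_left (hB _) (inv_pos.2 hc0).le)
  rw [integral_const_mul] at h
  have hin : ∀ x : ℝ, inner ℝ c (y + (x - inner ℝ e y) • e) = ‖c‖ * x := fun x => by
    rw [hce, inner_smul_left, inner_add_right, inner_smul_right, real_inner_self_eq_norm_sq, he,
      ← hce]
    simp
  simp_rw [hin, mul_assoc]
  rw [integral_const_mul, h]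
  field_simp

end Stein

/-! ### The Sudakov–Fernique comparison -/

section SudakovFernique

variable {ι : Type*} [Fintype ι]

noncomputable def logSumExp (z : ι → ℝ) : ℝ := Real.log (∑ i, Real.exp (z i))

noncomputable def gibbsWeight (z : ι → ℝ) (i : ι) : ℝ := Real.exp (z i) / ∑ j, Real.exp (z j)

theorem gibbsWeight_nonneg (z : ι → ℝ) (i : ι) : 0 ≤ gibbsWeight z i := by
  unfold gibbsWeight
  positivity

theorem le_logSumExp (z : ι → ℝ) (i : ι) : z i ≤ logSumExp z := by
  have h := Finset.single_le_sum (f := fun i => Real.exp (z i)) (fun j _ => (Real.exp_pos _).le)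
    (Finset.mem_univ i)
  exact (Real.le_log_iff_exp_le ((Real.exp_pos _).trans_le h)).2 h

variable [Nonempty ι]

theorem sum_exp_pos (z : ι → ℝ) : 0 < ∑ i, Real.exp (z i) :=
  Finset.sum_pos (fun _ _ => Real.exp_pos _) Finset.univ_nonempty

theorem sum_gibbsWeight (z : ι → ℝ) : ∑ i, gibbsWeight z i = 1 := by
  simp only [gibbsWeight]
  rw [← Finset.sum_div, div_self (sum_exp_pos z).ne']

theorem gibbsWeight_le_one (z : ι → ℝ) (i : ι) : gibbsWeight z i ≤ 1 := by
  rw [← sum_gibbsWeight z]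
  exact Finset.single_le_sum (fun j _ => gibbsWeight_nonneg z j) (Finset.mem_univ i)

theorem abs_gibbsWeight_le_one (z : ι → ℝ) (i : ι) : |gibbsWeight z i| ≤ 1 := by
  rw [abs_of_nonneg (gibbsWeight_nonneg z i)]
  exact gibbsWeight_le_one z i

/-- With `le_logSumExp`, this places the soft maximum within `log N` of the true maximum, `N` being
the number of indices. -/
theorem logSumExp_le {z : ι → ℝ} {m : ℝ} (h : ∀ i, z i ≤ m) :
    logSumExp z ≤ m + Real.log (Fintype.card ι) := by
  have hc : (0 : ℝ) < Fintype.card ι := by exact_mod_cast Fintype.card_pos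
  rw [logSumExp, Real.log_le_iff_le_exp (sum_exp_pos z), Real.exp_add, Real.exp_log hc]
  calc ∑ i, Real.exp (z i) ≤ ∑ _i : ι, Real.exp m :=
        Finset.sum_le_sum fun i _ => Real.exp_le_exp.2 (h i)
    _ = Real.exp m * Fintype.card ι := by
        rw [Finset.sum_const, nsmul_eq_mul, mul_comm, Finset.card_univ]

theorem abs_logSumExp_le (z : ι → ℝ) :
    |logSumExp z| ≤ ∑ i, |z i| + Real.log (Fintype.card ι) := by
  have hle : ∀ i, |z i| ≤ ∑ i, |z i| := fun i =>
    Finset.single_le_sum (f := fun i => |z i|) (fun j _ => abs_nonneg _) (Finset.mem_univ i)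
  have hc : 0 ≤ Real.log (Fintype.card ι) := Real.log_natCast_nonneg _
  obtain ⟨i⟩ := ‹Nonempty ι›
  rw [abs_le]
  constructor
  · have := le_logSumExp z i
    have := neg_abs_le (z i)
    have := hle i
    linarith
  · exact logSumExp_le fun i => (le_abs_self _).trans (hle i)

theorem hasDerivAt_logSumExp {z : ℝ → ι → ℝ} {z' : ι → ℝ} {t : ℝ}
    (hz : ∀ i, HasDerivAt (fun t => z t i) (z' i) t) :
    HasDerivAt (fun t => logSumExp (z t)) (∑ i, gibbsWeight (z t) i * z' i) t := by
  have h := (HasDerivAt.fun_sum (u := Finset.univ) fun i _ => (hz i).exp).log (sum_exp_pos (z t)).ne'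
  refine h.congr_deriv ?_
  rw [Finset.sum_div]
  refine Finset.sum_congr rfl fun i _ => ?_
  rw [gibbsWeight]
  ring

theorem hasDerivAt_gibbsWeight {z : ℝ → ι → ℝ} {z' : ι → ℝ} {t : ℝ}
    (hz : ∀ i, HasDerivAt (fun t => z t i) (z' i) t) (i : ι) :
    HasDerivAt (fun t => gibbsWeight (z t) i)
      (gibbsWeight (z t) i * (z' i - ∑ j, gibbsWeight (z t) j * z' j)) t := by
  have hS := (sum_exp_pos (z t)).ne'
  have h := (hz i).exp.div (HasDerivAt.fun_sum (u := Finset.univ) fun i _ => (hz i).exp) hS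
  refine h.congr_deriv ?_
  have : ∑ j, gibbsWeight (z t) j * z' j
      = (∑ j, Real.exp (z t j) * z' j) / ∑ j, Real.exp (z t j) := by
    rw [Finset.sum_div]
    refine Finset.sum_congr rfl fun i _ => ?_
    rw [gibbsWeight]
    ring
  rw [this, gibbsWeight]
  field_simp

theorem continuous_gibbsWeight (i : ι) : Continuous fun z : ι → ℝ => gibbsWeight z i := by
  unfold gibbsWeight
  exact Continuous.div (by fun_prop) (by fun_prop) fun z => (sum_exp_pos z).ne'

theorem continuous_logSumExp : Continuous (logSumExp : (ι → ℝ) → ℝ) := by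
  unfold logSumExp
  exact Continuous.log (by fun_prop) fun z => (sum_exp_pos z).ne'

/-- Since the weights sum to one, symmetrising in `i, j` rewrites the sum as half of `∑ p_i p_j
(D_ii + D_jj - 2 D_ij)`. -/
theorem sum_gibbsWeight_mul_nonpos (z : ι → ℝ) {D : ι → ι → ℝ} (hsymm : ∀ i j, D i j = D j i)
    (hD : ∀ i j, D i i + D j j - 2 * D i j ≤ 0) :
    ∑ i, gibbsWeight z i * (D i i - ∑ j, gibbsWeight z j * D i j) ≤ 0 := by
  set p := gibbsWeight z
  have hp : ∑ i, p i = 1 := sum_gibbsWeight z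
  have h1 : ∑ i, p i * (D i i - ∑ j, p j * D i j)
      = ∑ i, ∑ j, p i * p j * (D i i - D i j) := by
    refine Finset.sum_congr rfl fun i _ => ?_
    calc p i * (D i i - ∑ j, p j * D i j)
        = p i * ((∑ j, p j) * D i i - ∑ j, p j * D i j) := by rw [hp, one_mul]
      _ = ∑ j, p i * p j * (D i i - D i j) := by
        rw [Finset.sum_mul, ← Finset.sum_sub_distrib, Finset.mul_sum]
        exact Finset.sum_congr rfl fun j _ => by ring
  have h2 : ∑ i, ∑ j, p i * p j * (D i i - D i j) = ∑ i, ∑ j, p i * p j * (D j j - D i j) := by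
    rw [Finset.sum_comm]
    refine Finset.sum_congr rfl fun i _ => Finset.sum_congr rfl fun j _ => ?_
    rw [hsymm j i]
    ring
  have h3 : ∑ i, ∑ j, p i * p j * (D i i - D i j) + ∑ i, ∑ j, p i * p j * (D j j - D i j) ≤ 0 := by
    rw [← Finset.sum_add_distrib]
    refine Finset.sum_nonpos fun i _ => ?_
    rw [← Finset.sum_add_distrib]
    refine Finset.sum_nonpos fun j _ => ?_
    rw [← mul_add]
    refine mul_nonpos_of_nonneg_of_nonpos
      (mul_nonneg (gibbsWeight_nonneg z i) (gibbsWeight_nonneg z j)) ?_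
    linarith [hD i j]
  rw [h1]
  linarith

variable {H : Type*} [NormedAddCommGroup H] [InnerProductSpace ℝ H]

theorem continuous_gibbsWeight_inner (c : ι → H) (i : ι) :
    Continuous fun x : H => gibbsWeight (fun j => inner ℝ (c j) x) i :=
  (continuous_gibbsWeight i).comp
    (continuous_pi (f := fun (x : H) j => inner ℝ (c j) x) fun _ => by fun_prop)

variable [FiniteDimensional ℝ H] [MeasurableSpace H] [BorelSpace H]

theorem integrable_inner_stdGaussian (c : H) :
    Integrable (fun x : H => inner ℝ c x) (stdGaussian H) :=
  (IsGaussian.integrable_id (μ := stdGaussian H)).const_inner c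

theorem integrable_logSumExp_inner (c : ι → H) :
    Integrable (fun x : H => logSumExp fun i => inner ℝ (c i) x) (stdGaussian H) := by
  refine Integrable.mono' (g := fun x => ∑ i, |inner ℝ (c i) x| + Real.log (Fintype.card ι)) ?_
    (continuous_logSumExp.comp (continuous_pi (f := fun (x : H) j => inner ℝ (c j) x)
      fun _ => by fun_prop)).aestronglyMeasurable
    (ae_of_all _ fun x => abs_logSumExp_le _)
  exact (integrable_finsetSum _ fun i _ => (integrable_inner_stdGaussian (c i)).abs).add
    (integrable_const _)

/-- Integration by parts in the direction `c' i`, applied to the `i`-th Gibbs weight, leaves only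
inner products of `c'` with `c`. -/
theorem integral_sum_gibbsWeight_mul (c c' : ι → H) :
    ∫ x, ∑ i, gibbsWeight (fun j => inner ℝ (c j) x) i * inner ℝ (c' i) x ∂(stdGaussian H)
      = ∫ x, ∑ i, gibbsWeight (fun j => inner ℝ (c j) x) i *
          (inner ℝ (c' i) (c i) - ∑ j, gibbsWeight (fun j => inner ℝ (c j) x) j *
            inner ℝ (c' i) (c j)) ∂(stdGaussian H) := by
  have hcont : ∀ i, Continuous fun x : H => gibbsWeight (fun j => inner ℝ (c j) x) i := 
    continuous_gibbsWeight_inner c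
  have hψcont : ∀ i, Continuous fun x : H => gibbsWeight (fun j => inner ℝ (c j) x) i *
      (inner ℝ (c' i) (c i) - ∑ j, gibbsWeight (fun j => inner ℝ (c j) x) j *
        inner ℝ (c' i) (c j)) := fun i =>
    (hcont i).mul (continuous_const.sub (continuous_finsetSum _ fun j _ =>
      (hcont j).mul continuous_const))
  have hψb : ∀ i (x : H), |gibbsWeight (fun j => inner ℝ (c j) x) i *
      (inner ℝ (c' i) (c i) - ∑ j, gibbsWeight (fun j => inner ℝ (c j) x) j *
        inner ℝ (c' i) (c j))|
      ≤ |inner ℝ (c' i) (c i)| + ∑ j, |inner ℝ (c' i) (c j)| := fun i x => by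
    rw [abs_mul]
    refine (mul_le_of_le_one_left (abs_nonneg _) (abs_gibbsWeight_le_one _ _)).trans ?_
    refine (abs_sub _ _).trans (add_le_add le_rfl ((Finset.abs_sum_le_sum_abs _ _).trans
      (Finset.sum_le_sum fun j _ => ?_)))
    rw [abs_mul]
    exact mul_le_of_le_one_left (abs_nonneg _) (abs_gibbsWeight_le_one _ _)
  rw [integral_finsetSum, integral_finsetSum]
  · refine Finset.sum_congr rfl fun i _ => ?_
    have h := integral_inner_mul_stdGaussian (c' i)
      (φ := fun x => gibbsWeight (fun j => inner ℝ (c j) x) i)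
      (ψ := fun x => gibbsWeight (fun j => inner ℝ (c j) x) i *
        (inner ℝ (c' i) (c i) - ∑ j, gibbsWeight (fun j => inner ℝ (c j) x) j *
          inner ℝ (c' i) (c j)))
      (fun x => ?_) (hcont i).measurable (hψcont i).measurable
      (fun x => abs_gibbsWeight_le_one _ _) (hψb i)
    · rw [← h]
      simp_rw [mul_comm]
    · have hz : ∀ j, HasDerivAt (fun t : ℝ => inner ℝ (c j) (x + t • c' i))
          (inner ℝ (c' i) (c j)) 0 := fun j => by
        have : (fun t : ℝ => inner ℝ (c j) (x + t • c' i))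
            = fun t => inner ℝ (c j) x + t * inner ℝ (c' i) (c j) := by
          ext t
          rw [inner_add_right, inner_smul_right, real_inner_comm (c j) (c' i)]
        rw [this]
        simpa using ((hasDerivAt_id (0 : ℝ)).mul_const (inner ℝ (c' i) (c j))).const_add
          (inner ℝ (c j) x)
      simpa using hasDerivAt_gibbsWeight hz i
  · exact fun i _ => Integrable.of_bound (hψcont i).aestronglyMeasurable _ (ae_of_all _ (hψb i))
  · exact fun i _ => (integrable_inner_stdGaussian (c' i)).bdd_mul
      (hcont i).aestronglyMeasurable (ae_of_all _ fun x => abs_gibbsWeight_le_one _ _)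

/-- Comparison of soft maxima of Gaussian families with dominated increments. -/
theorem integral_logSumExp_le {a b : ι → H} (hab : ∀ i j, inner ℝ (a i) (b j) = 0)
    (h : ∀ i j, ‖a i - a j‖ ≤ ‖b i - b j‖) :
    ∫ x, logSumExp (fun i => inner ℝ (a i) x) ∂(stdGaussian H)
      ≤ ∫ x, logSumExp (fun i => inner ℝ (b i) x) ∂(stdGaussian H) := by
  -- A rotation from `b` at `θ = 0` to `a` at `θ = π / 2`; `c'` is its derivative. Orthogonality of
  -- the families makes them independent under one Gaussian vector.
  let c : ℝ → ι → H := fun θ i => Real.cos θ • b i + Real.sin θ • a i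
  let c' : ℝ → ι → H := fun θ i => -Real.sin θ • b i + Real.cos θ • a i
  let F' : ℝ → H → ℝ := fun θ x =>
    ∑ i, gibbsWeight (fun j => inner ℝ (c θ j) x) i * inner ℝ (c' θ i) x
  have hz : ∀ x i θ, HasDerivAt (fun θ => inner ℝ (c θ i) x) (inner ℝ (c' θ i) x) θ := by
    intro x i θ
    have h1 := ((Real.hasDerivAt_cos θ).mul_const (inner ℝ (b i) x)).add
      ((Real.hasDerivAt_sin θ).mul_const (inner ℝ (a i) x))
    simp only [c, c', inner_add_left, inner_smul_left, conj_trivial]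
    exact h1
  have hF : ∀ θ, HasDerivAt
      (fun θ => ∫ x, logSumExp (fun i => inner ℝ (c θ i) x) ∂(stdGaussian H))
      (∫ x, F' θ x ∂(stdGaussian H)) θ := by
    intro θ
    refine (hasDerivAt_integral_of_dominated_loc_of_deriv_le (s := Set.univ)
      (bound := fun x => ∑ i, (‖b i‖ + ‖a i‖) * ‖x‖) Filter.univ_mem
      (Filter.Eventually.of_forall fun θ => (integrable_logSumExp_inner _).aestronglyMeasurable)
      (integrable_logSumExp_inner _) ?_ (ae_of_all _ fun x θ _ => ?_) ?_
      (ae_of_all _ fun x θ _ => hasDerivAt_logSumExp fun i => hz x i θ)).2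
    · refine Continuous.aestronglyMeasurable (continuous_finsetSum _ fun i _ => ?_)
      exact (continuous_gibbsWeight_inner (c θ) i).mul
        (continuous_const.inner continuous_id)
    · refine (norm_sum_le _ _).trans (Finset.sum_le_sum fun i _ => ?_)
      rw [norm_mul]
      refine (mul_le_of_le_one_left (norm_nonneg _) (abs_gibbsWeight_le_one _ _)).trans ?_
      refine (norm_inner_le_norm _ _).trans (mul_le_mul_of_nonneg_right ?_ (norm_nonneg _))
      refine (norm_add_le _ _).trans ?_
      rw [norm_smul, norm_smul]
      refine add_le_add (mul_le_of_le_one_left (norm_nonneg _) ?_)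
        (mul_le_of_le_one_left (norm_nonneg _) ?_)
      · rw [norm_neg]
        exact Real.abs_sin_le_one θ
      · exact Real.abs_cos_le_one θ
    · exact integrable_finsetSum _ fun i _ =>
        (IsGaussian.integrable_id (μ := stdGaussian H)).norm.const_mul _
  have hle : ∀ θ ∈ Set.Icc 0 (Real.pi / 2), ∫ x, F' θ x ∂(stdGaussian H) ≤ 0 := by
    intro θ hθ
    have hsin : 0 ≤ Real.sin θ := Real.sin_nonneg_of_nonneg_of_le_pi hθ.1
      (by linarith [hθ.2, Real.pi_pos])
    have hcos : 0 ≤ Real.cos θ := Real.cos_nonneg_of_neg_pi_div_two_le_of_le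
      (by linarith [hθ.1, Real.pi_pos]) hθ.2
    have hinner : ∀ i j, inner ℝ (c' θ i) (c θ j)
        = Real.sin θ * Real.cos θ * (inner ℝ (a i) (a j) - inner ℝ (b i) (b j)) := fun i j => by
      simp only [c, c', inner_add_left, inner_add_right, inner_smul_left, inner_smul_right,
        conj_trivial, hab, real_inner_comm (a j) (b i)]
      ring
    rw [integral_sum_gibbsWeight_mul]
    refine integral_nonpos fun x => sum_gibbsWeight_mul_nonpos _
      (D := fun i j => inner ℝ (c' θ i) (c θ j)) (fun i j => ?_) fun i j => ?_
    · simp only [hinner, real_inner_comm]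
    -- This is where dominated increments enter: they make the derivative in `θ` nonpositive.
    · have h1 : inner ℝ (c' θ i) (c θ i) + inner ℝ (c' θ j) (c θ j) - 2 * inner ℝ (c' θ i) (c θ j)
          = Real.sin θ * Real.cos θ * (‖a i - a j‖ ^ 2 - ‖b i - b j‖ ^ 2) := by
        rw [norm_sub_sq_real, norm_sub_sq_real, hinner, hinner, hinner,
          real_inner_self_eq_norm_sq, real_inner_self_eq_norm_sq, real_inner_self_eq_norm_sq,
          real_inner_self_eq_norm_sq]
        ring
      rw [h1]
      refine mul_nonpos_of_nonneg_of_nonpos (mul_nonneg hsin hcos) ?_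
      have := pow_le_pow_left₀ (norm_nonneg _) (h i j) 2
      linarith
  have hanti := antitoneOn_of_deriv_nonpos (convex_Icc 0 (Real.pi / 2))
    (fun θ _ => (hF θ).continuousAt.continuousWithinAt)
    (fun θ _ => (hF θ).differentiableAt.differentiableWithinAt)
    (fun θ hθ => (hF θ).deriv ▸ hle θ (interior_subset hθ))
  have := hanti (Set.left_mem_Icc.2 (by positivity)) (Set.right_mem_Icc.2 (by positivity))
    (by positivity)
  simpa [c] using this

/-- The Sudakov–Fernique inequality. -/
theorem sudakov_fernique {a b : ι → H} (hab : ∀ i j, inner ℝ (a i) (b j) = 0)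
    (h : ∀ i j, ‖a i - a j‖ ≤ ‖b i - b j‖) {m M : H → ℝ} (hm : Integrable m (stdGaussian H))
    (hM : Integrable M (stdGaussian H)) (hma : ∀ x, ∃ i, m x ≤ inner ℝ (a i) x)
    (hMb : ∀ x i, inner ℝ (b i) x ≤ M x) :
    ∫ x, m x ∂(stdGaussian H) ≤ ∫ x, M x ∂(stdGaussian H) := by
  -- Scaling both families by `β` leaves the error `log N` unchanged, so it becomes negligible for
  -- large `β`.
  have key : ∀ β : ℝ, 0 < β → β * ∫ x, m x ∂(stdGaussian H)
      ≤ β * ∫ x, M x ∂(stdGaussian H) + Real.log (Fintype.card ι) := by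
    intro β hβ
    have h1 := integral_logSumExp_le (a := fun i => β • a i) (b := fun i => β • b i)
      (fun i j => by rw [inner_smul_left, inner_smul_right, hab]; simp) (fun i j => by
        rw [← smul_sub, ← smul_sub, norm_smul, norm_smul]
        exact mul_le_mul_of_nonneg_left (h i j) (norm_nonneg _))
    have h2 : ∫ x, β * m x ∂(stdGaussian H)
        ≤ ∫ x, logSumExp (fun i => inner ℝ (β • a i) x) ∂(stdGaussian H) := by
      refine integral_mono (hm.const_mul β) (integrable_logSumExp_inner _) fun x => ?_
      obtain ⟨i, hi⟩ := hma x
      refine le_trans ?_ (le_logSumExp _ i)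
      rw [inner_smul_left]
      exact mul_le_mul_of_nonneg_left hi hβ.le
    have h3 : ∫ x, logSumExp (fun i => inner ℝ (β • b i) x) ∂(stdGaussian H)
        ≤ ∫ x, (β * M x + Real.log (Fintype.card ι)) ∂(stdGaussian H) := by
      refine integral_mono (integrable_logSumExp_inner _)
        ((hM.const_mul β).add (integrable_const _)) fun x => logSumExp_le fun i => ?_
      rw [inner_smul_left]
      exact mul_le_mul_of_nonneg_left (hMb x i) hβ.le
    rw [integral_const_mul] at h2
    rw [integral_add (hM.const_mul β) (integrable_const _), integral_const_mul] at h3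
    simp only [integral_const, probReal_univ, one_smul] at h3
    linarith
  by_contra! hlt
  have hpos := sub_pos.2 hlt
  have hc : 0 ≤ Real.log (Fintype.card ι) := Real.log_natCast_nonneg _
  -- This `β` makes a positive gap, once multiplied by `β`, equal to `log N + 1`, exceeding the
  -- permitted error.
  have := key ((Real.log (Fintype.card ι) + 1) / (∫ x, m x ∂(stdGaussian H)
    - ∫ x, M x ∂(stdGaussian H))) (by positivity)
  have e : (Real.log (Fintype.card ι) + 1) / (∫ x, m x ∂(stdGaussian H)
    - ∫ x, M x ∂(stdGaussian H)) * (∫ x, m x ∂(stdGaussian H) - ∫ x, M x ∂(stdGaussian H))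
    = Real.log (Fintype.card ι) + 1 := div_mul_cancel₀ _ hpos.ne'
  rw [mul_sub] at e
  linarith

end SudakovFernique

/-! ### Chevet's inequality and low-rank matrices -/

section Chevet

theorem stdGaussian_map_of_inner_eq {E F : Type*} [NormedAddCommGroup E] [InnerProductSpace ℝ E]
    [FiniteDimensional ℝ E] [MeasurableSpace E] [BorelSpace E] [NormedAddCommGroup F]
    [InnerProductSpace ℝ F] [FiniteDimensional ℝ F] [MeasurableSpace F] [BorelSpace F]
    {S : E → F} (hS : Measurable S) (T : F → E)
    (h : ∀ x t, inner ℝ (S x) t = inner ℝ x (T t)) (hT : ∀ t, ‖T t‖ = ‖t‖) :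
    (stdGaussian E).map S = stdGaussian F := by
  apply Measure.ext_of_charFun
  ext t
  have h1 : charFun ((stdGaussian E).map S) t = charFun (stdGaussian E) (T t) := by
    rw [charFun_apply, charFun_apply, integral_map hS.aemeasurable (by fun_prop)]
    simp_rw [h]
  rw [h1, charFun_stdGaussian, charFun_stdGaussian, hT]

/-- The union bound for the single subspace `⊤` allows every `b > 0`; then `b` tends to `0`. -/
theorem integral_norm_stdGaussian_le {E : Type*} [NormedAddCommGroup E] [InnerProductSpace ℝ E]
    [FiniteDimensional ℝ E] [MeasurableSpace E] [BorelSpace E] (hE : 1 ≤ Module.finrank ℝ E) :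
    ∫ x : E, ‖x‖ ∂(stdGaussian E) ≤ √(Module.finrank ℝ E) := by
  refine le_of_forall_pos_le_add fun b hb => ?_
  have h := gaussianWidth_le_of_subset_iUnion_subspace (ι := Unit) (fun _ => (⊤ : Submodule ℝ E))
    (K := Metric.closedBall 0 1) (fun v hv => ⟨by simpa using hv, (), trivial⟩) hE
    (fun _ => finrank_top ℝ E |>.le) hb (by
      rw [Fintype.card_unit, Nat.cast_one, Real.one_le_exp_iff]
      positivity)
  rw [← ENNReal.ofReal_le_ofReal_iff (by positivity), ofReal_integral_eq_lintegral_ofReal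
    (f := fun x : E => ‖x‖) (IsGaussian.integrable_id (μ := stdGaussian E)).norm
    (ae_of_all _ fun x => norm_nonneg _)]
  refine le_trans (lintegral_mono fun x => ?_) h
  rcases eq_or_ne x 0 with rfl | hx
  · simp
  have hx' : 0 < ‖x‖ := norm_pos_iff.2 hx
  refine le_trans (le_of_eq ?_) (le_iSup₂ (f := fun (v : E) (_ : v ∈ Metric.closedBall (0 : E) 1) =>
    ENNReal.ofReal |inner ℝ x v|) (‖x‖⁻¹ • x) (by simp [norm_smul, hx'.ne']))
  rw [inner_smul_right, real_inner_self_eq_norm_sq]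
  congr 1
  rw [abs_of_nonneg (by positivity)]
  field_simp

variable {m n : ℕ}

/-- The matrix `u vᵀ`. -/
noncomputable def outerVec (u : EuclideanSpace ℝ (Fin m)) (v : EuclideanSpace ℝ (Fin n)) :
    EuclideanSpace ℝ (Fin m × Fin n) :=
  WithLp.toLp 2 fun p => u p.1 * v p.2

theorem inner_outerVec_outerVec (u u' : EuclideanSpace ℝ (Fin m))
    (v v' : EuclideanSpace ℝ (Fin n)) :
    inner ℝ (outerVec u v) (outerVec u' v') = inner ℝ u u' * inner ℝ v v' := by
  simp only [PiLp.inner_apply, outerVec, RCLike.inner_apply, conj_trivial, Fintype.sum_prod_type,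
    Finset.sum_mul_sum]
  exact Finset.sum_congr rfl fun i _ => Finset.sum_congr rfl fun j _ => by ring

theorem outerVec_smul_left (c : ℝ) (u : EuclideanSpace ℝ (Fin m))
    (v : EuclideanSpace ℝ (Fin n)) : outerVec (c • u) v = c • outerVec u v := by
  ext p
  simp [outerVec, mul_assoc]

theorem outerVec_smul_right (c : ℝ) (u : EuclideanSpace ℝ (Fin m))
    (v : EuclideanSpace ℝ (Fin n)) : outerVec u (c • v) = c • outerVec u v := by
  ext p
  simp only [outerVec, PiLp.smul_apply, smul_eq_mul]
  ring

theorem norm_outerVec (u : EuclideanSpace ℝ (Fin m)) (v : EuclideanSpace ℝ (Fin n)) :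
    ‖outerVec u v‖ = ‖u‖ * ‖v‖ := by
  have h := inner_outerVec_outerVec u u v v
  rw [real_inner_self_eq_norm_sq, real_inner_self_eq_norm_sq, real_inner_self_eq_norm_sq,
    ← mul_pow] at h
  exact (pow_left_inj₀ (norm_nonneg _) (by positivity) two_ne_zero).1 h

theorem continuous_outerVec : Continuous fun p : EuclideanSpace ℝ (Fin m) ×
    EuclideanSpace ℝ (Fin n) => outerVec p.1 p.2 := by
  unfold outerVec
  fun_prop

/-- The domain of a Gaussian matrix together with two independent Gaussian vectors. -/
abbrev JointSpace (m n : ℕ) : Type := EuclideanSpace ℝ ((Fin m × Fin n) ⊕ (Fin m ⊕ Fin n))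

/-- Chevet's inequality for finitely many rank one matrices. -/
theorem lintegral_iSup_inner_outerVec_le {ι : Type*} [Fintype ι] [Nonempty ι] (hm : 1 ≤ m)
    (hn : 1 ≤ n) (u : ι → EuclideanSpace ℝ (Fin m)) (v : ι → EuclideanSpace ℝ (Fin n))
    (hu : ∀ i, ‖u i‖ = 1) (hv : ∀ i, ‖v i‖ = 1) :
    ∫⁻ g, ⨆ i, ENNReal.ofReal |inner ℝ g (outerVec (u i) (v i))|
      ∂(stdGaussian (EuclideanSpace ℝ (Fin m × Fin n))) ≤ ENNReal.ofReal (√m + √n) := by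
  let T₀ : EuclideanSpace ℝ (Fin m × Fin n) → JointSpace m n := fun t => WithLp.toLp 2 (Sum.elim t 0)
  let T₁ : EuclideanSpace ℝ (Fin m) → JointSpace m n := fun t => WithLp.toLp 2 (Sum.elim 0 (Sum.elim t 0))
  let T₂ : EuclideanSpace ℝ (Fin n) → JointSpace m n := fun t => WithLp.toLp 2 (Sum.elim 0 (Sum.elim 0 t))
  let S₀ : JointSpace m n → EuclideanSpace ℝ (Fin m × Fin n) := fun x => WithLp.toLp 2 fun p => x (Sum.inl p)
  let S₁ : JointSpace m n → EuclideanSpace ℝ (Fin m) := fun x => WithLp.toLp 2 fun i => x (Sum.inr (Sum.inl i))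
  let S₂ : JointSpace m n → EuclideanSpace ℝ (Fin n) := fun x => WithLp.toLp 2 fun i => x (Sum.inr (Sum.inr i))
  have hS₀ : Measurable S₀ := by fun_prop
  have hS₁ : Measurable S₁ := by fun_prop
  have hS₂ : Measurable S₂ := by fun_prop
  have hST₀ : ∀ x t, inner ℝ (S₀ x) t = inner ℝ x (T₀ t) := fun x t => by
    simp [PiLp.inner_apply, S₀, T₀]
  have hST₁ : ∀ x t, inner ℝ (S₁ x) t = inner ℝ x (T₁ t) := fun x t => by
    simp [PiLp.inner_apply, S₁, T₁]
  have hST₂ : ∀ x t, inner ℝ (S₂ x) t = inner ℝ x (T₂ t) := fun x t => by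
    simp [PiLp.inner_apply, S₂, T₂]
  have hT₀₀ : ∀ s t, inner ℝ (T₀ s) (T₀ t) = inner ℝ s t := fun s t => by
    simp [PiLp.inner_apply, T₀]
  have hT₁₁ : ∀ s t, inner ℝ (T₁ s) (T₁ t) = inner ℝ s t := fun s t => by
    simp [PiLp.inner_apply, T₁]
  have hT₂₂ : ∀ s t, inner ℝ (T₂ s) (T₂ t) = inner ℝ s t := fun s t => by
    simp [PiLp.inner_apply, T₂]
  have hT₀₁ : ∀ s t, inner ℝ (T₀ s) (T₁ t) = 0 := fun s t => by
    simp [PiLp.inner_apply, T₀, T₁]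
  have hT₀₂ : ∀ s t, inner ℝ (T₀ s) (T₂ t) = 0 := fun s t => by
    simp [PiLp.inner_apply, T₀, T₂]
  have hT₁₂ : ∀ s t, inner ℝ (T₁ s) (T₂ t) = 0 := fun s t => by
    simp [PiLp.inner_apply, T₁, T₂]
  have hmap₀ := stdGaussian_map_of_inner_eq hS₀ T₀ hST₀ fun t => by
    rw [norm_eq_sqrt_real_inner, hT₀₀, ← norm_eq_sqrt_real_inner]
  have hmap₁ := stdGaussian_map_of_inner_eq hS₁ T₁ hST₁ fun t => by
    rw [norm_eq_sqrt_real_inner, hT₁₁, ← norm_eq_sqrt_real_inner]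
  have hmap₂ := stdGaussian_map_of_inner_eq hS₂ T₂ hST₂ fun t => by
    rw [norm_eq_sqrt_real_inner, hT₂₂, ← norm_eq_sqrt_real_inner]
  -- Indexing by signs turns the maximum of absolute values into a plain maximum.
  let σ : Bool → ℝ := fun b => if b then 1 else -1
  have hσ : ∀ b (w : EuclideanSpace ℝ (Fin m)), ‖σ b • w‖ = ‖w‖ := fun b w => by
    cases b <;> simp [σ]
  let a : ι × Bool → JointSpace m n := fun p => T₀ (outerVec (σ p.2 • u p.1) (v p.1))
  let b : ι × Bool → JointSpace m n := fun p => T₁ (σ p.2 • u p.1) + T₂ (v p.1)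
  have hab : ∀ i j, inner ℝ (a i) (b j) = 0 := fun i j => by
    simp only [a, b, inner_add_right, hT₀₁, hT₀₂, add_zero]
  have hincr : ∀ i j, ‖a i - a j‖ ≤ ‖b i - b j‖ := fun i j => by
    refine (pow_le_pow_iff_left₀ (norm_nonneg _) (norm_nonneg _) two_ne_zero).1 ?_
    have hp := real_inner_le_norm (σ i.2 • u i.1) (σ j.2 • u j.1)
    have hq := real_inner_le_norm (v i.1) (v j.1)
    rw [hσ, hσ, hu, hu, mul_one] at hp
    rw [hv, hv, mul_one] at hq
    have ha : ∀ i, ‖a i‖ ^ 2 = 1 := fun i => by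
      rw [← real_inner_self_eq_norm_sq, hT₀₀, real_inner_self_eq_norm_sq, norm_outerVec, hσ, hu, hv]
      norm_num
    have hbb : ∀ i j, inner ℝ (b i) (b j)
        = inner ℝ (σ i.2 • u i.1) (σ j.2 • u j.1) + inner ℝ (v i.1) (v j.1) := fun i j => by
      simp only [b, inner_add_left, inner_add_right, hT₁₁, hT₂₂, hT₁₂]
      rw [real_inner_comm _ (T₂ _), hT₁₂]
      ring
    have hb : ∀ i, ‖b i‖ ^ 2 = 2 := fun i => by
      rw [← real_inner_self_eq_norm_sq, hbb, real_inner_self_eq_norm_sq,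
        real_inner_self_eq_norm_sq, hσ, hu, hv]
      norm_num
    -- With `p, q ≤ 1` the two inner products, the claim `2 - 2pq ≤ 4 - 2p - 2q` is `(1 - p)(1 - q)
    -- ≥ 0`.
    rw [norm_sub_sq_real, norm_sub_sq_real, ha, ha, hb, hb, hbb, hT₀₀, inner_outerVec_outerVec]
    nlinarith
  let μ : EuclideanSpace ℝ (Fin m × Fin n) → ℝ := fun g => ⨆ i, |inner ℝ g (outerVec (u i) (v i))|
  have hle : ∀ g i, |inner ℝ g (outerVec (u i) (v i))| ≤ μ g := fun g i =>
    le_ciSup (f := fun i => |inner ℝ g (outerVec (u i) (v i))|) (Set.finite_range _).bddAbove i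
  have hex : ∀ g, ∃ i, |inner ℝ g (outerVec (u i) (v i))| = μ g := fun g =>
    exists_eq_ciSup_of_finite
  have hμ0 : ∀ g, 0 ≤ μ g := fun g => by
    obtain ⟨i, hi⟩ := hex g
    exact hi ▸ abs_nonneg _
  have hμm : Measurable μ := Measurable.iSup fun i => by fun_prop
  have hμi : Integrable μ (stdGaussian (EuclideanSpace ℝ (Fin m × Fin n))) := by
    refine Integrable.mono' (IsGaussian.integrable_id (μ := stdGaussian _)).norm
      hμm.aestronglyMeasurable (ae_of_all _ fun g => ?_)
    obtain ⟨i, hi⟩ := hex g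
    rw [Real.norm_of_nonneg (hμ0 g), ← hi]
    refine (abs_real_inner_le_norm _ _).trans_eq ?_
    rw [norm_outerVec, hu, hv, mul_one, mul_one, id]
  have hN₁ : Integrable (fun x : JointSpace m n => ‖S₁ x‖) (stdGaussian (JointSpace m n)) := by
    have h := (IsGaussian.integrable_id (μ := stdGaussian (EuclideanSpace ℝ (Fin m)))).norm
    rw [← hmap₁] at h
    exact h.comp_measurable hS₁
  have hN₂ : Integrable (fun x : JointSpace m n => ‖S₂ x‖) (stdGaussian (JointSpace m n)) := by
    have h := (IsGaussian.integrable_id (μ := stdGaussian (EuclideanSpace ℝ (Fin n)))).norm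
    rw [← hmap₂] at h
    exact h.comp_measurable hS₂
  have hsf := sudakov_fernique hab hincr (m := fun x => μ (S₀ x)) (M := fun x => ‖S₁ x‖ + ‖S₂ x‖)
    ((hmap₀ ▸ hμi : Integrable μ ((stdGaussian (JointSpace m n)).map S₀)).comp_measurable hS₀) (hN₁.add hN₂)
    (fun x => by
      obtain ⟨i, hi⟩ := hex (S₀ x)
      rcases abs_choice (inner ℝ (S₀ x) (outerVec (u i) (v i))) with h | h
      · refine ⟨(i, true), le_of_eq ?_⟩
        simp only [a, σ, if_true, one_smul]
        rw [real_inner_comm, ← hST₀, ← hi, h]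
      · refine ⟨(i, false), le_of_eq ?_⟩
        simp only [a, σ, Bool.false_eq_true, if_false, outerVec_smul_left]
        rw [real_inner_comm, ← hST₀, ← hi, h, inner_smul_right, neg_one_mul])
    (fun x p => by
      simp only [b, inner_add_left]
      rw [real_inner_comm, ← hST₁, real_inner_comm _ (T₂ _), ← hST₂]
      refine add_le_add ((real_inner_le_norm _ _).trans_eq ?_)
        ((real_inner_le_norm _ _).trans_eq ?_)
      · rw [hσ, hu, mul_one]
      · rw [hv, mul_one])
  have hi₀ : ∫ x, μ (S₀ x) ∂(stdGaussian (JointSpace m n)) = ∫ g, μ g ∂(stdGaussian _) := by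
    rw [← hmap₀, integral_map hS₀.aemeasurable hμm.aestronglyMeasurable]
  have hi₁ : ∫ x, ‖S₁ x‖ ∂(stdGaussian (JointSpace m n)) ≤ √m := by
    have h := integral_norm_stdGaussian_le (E := EuclideanSpace ℝ (Fin m)) (by simpa using hm)
    rwa [← hmap₁, integral_map hS₁.aemeasurable (by fun_prop), finrank_euclideanSpace_fin] at h
  have hi₂ : ∫ x, ‖S₂ x‖ ∂(stdGaussian (JointSpace m n)) ≤ √n := by
    have h := integral_norm_stdGaussian_le (E := EuclideanSpace ℝ (Fin n)) (by simpa using hn)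
    rwa [← hmap₂, integral_map hS₂.aemeasurable (by fun_prop), finrank_euclideanSpace_fin] at h
  rw [hi₀, integral_add hN₁ hN₂] at hsf
  calc _ ≤ ∫⁻ g, ENNReal.ofReal (μ g) ∂(stdGaussian _) :=
        lintegral_mono fun g => iSup_le fun i => ENNReal.ofReal_le_ofReal (hle g i)
    _ = ENNReal.ofReal (∫ g, μ g ∂(stdGaussian _)) :=
        (ofReal_integral_eq_lintegral_ofReal hμi (ae_of_all _ hμ0)).symm
    _ ≤ _ := ENNReal.ofReal_le_ofReal (by linarith)

/-- The operator norm of a Gaussian matrix is on average at most `√m + √n`. -/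
theorem exists_bound_inner_outerVec (hm : 1 ≤ m) (hn : 1 ≤ n) :
    ∃ M : EuclideanSpace ℝ (Fin m × Fin n) → ℝ≥0∞,
      ∫⁻ g, M g ∂(stdGaussian (EuclideanSpace ℝ (Fin m × Fin n))) ≤ ENNReal.ofReal (√m + √n) ∧
      (∀ g, M g ≠ ∞) ∧
      ∀ g u v, ‖u‖ = 1 → ‖v‖ = 1 → ENNReal.ofReal |inner ℝ g (outerVec u v)| ≤ M g := by
  have : Nonempty (Fin m) := ⟨⟨0, hm⟩⟩
  have : Nonempty (Fin n) := ⟨⟨0, hn⟩⟩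
  let Ω := Metric.sphere (0 : EuclideanSpace ℝ (Fin m)) 1 ×
    Metric.sphere (0 : EuclideanSpace ℝ (Fin n)) 1
  have : Nonempty (Metric.sphere (0 : EuclideanSpace ℝ (Fin m)) 1) :=
    (NormedSpace.sphere_nonempty.2 zero_le_one).to_subtype
  have : Nonempty (Metric.sphere (0 : EuclideanSpace ℝ (Fin n)) 1) :=
    (NormedSpace.sphere_nonempty.2 zero_le_one).to_subtype
  -- A dense sequence makes the supremum measurable and a monotone limit of finite ones; continuity
  -- recovers all unit pairs.
  let p : ℕ → Ω := TopologicalSpace.denseSeq Ω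
  have hp1 : ∀ k, ‖((p k).1 : EuclideanSpace ℝ (Fin m))‖ = 1 := fun k => by
    simp
  have hp2 : ∀ k, ‖((p k).2 : EuclideanSpace ℝ (Fin n))‖ = 1 := fun k => by
    simp
  let f : ℕ → EuclideanSpace ℝ (Fin m × Fin n) → ℝ≥0∞ := fun k g =>
    ENNReal.ofReal |inner ℝ g (outerVec (p k).1 (p k).2)|
  have hf : ∀ g, ⨆ k, f k g = ⨆ N : ℕ, ⨆ k : Fin (N + 1), f k g := fun g => by
    refine le_antisymm (iSup_le fun k => ?_) (iSup_le fun N => iSup_le fun k => ?_)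
    · exact le_iSup_of_le k (le_iSup (fun i : Fin (k + 1) => f i g) (Fin.last k))
    · exact le_iSup (fun i => f i g) k
  refine ⟨fun g => ⨆ k, f k g, ?_, fun g => ?_, fun g u v hu hv => ?_⟩
  · simp_rw [hf]
    rw [lintegral_iSup]
    · exact iSup_le fun N => lintegral_iSup_inner_outerVec_le hm hn
        (fun k : Fin (N + 1) => ((p k).1 : EuclideanSpace ℝ (Fin m)))
        (fun k => ((p k).2 : EuclideanSpace ℝ (Fin n))) (fun k => hp1 k) (fun k => hp2 k)
    · exact fun N => Measurable.iSup fun k => by fun_prop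
    · intro N N' hNN' g
      exact iSup_le fun k => le_iSup (fun i : Fin (N' + 1) => f i g) ⟨k, by omega⟩
  · refine ne_top_of_le_ne_top (ENNReal.ofReal_ne_top (r := ‖g‖)) (iSup_le fun k => ?_)
    refine ENNReal.ofReal_le_ofReal ((abs_real_inner_le_norm _ _).trans_eq ?_)
    rw [norm_outerVec, hp1, hp2, mul_one, mul_one]
  · have hcl : IsClosed {q : Ω | ENNReal.ofReal |inner ℝ g (outerVec q.1 q.2)| ≤ ⨆ k, f k g} := by
      refine isClosed_le (ENNReal.continuous_ofReal.comp ?_) continuous_const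
      have h : Continuous fun q : Ω => outerVec (q.1 : EuclideanSpace ℝ (Fin m))
          (q.2 : EuclideanSpace ℝ (Fin n)) :=
        continuous_outerVec.comp ((continuous_subtype_val.comp continuous_fst).prodMk
          (continuous_subtype_val.comp continuous_snd))
      exact (continuous_const.inner h).abs
    have hall := (TopologicalSpace.denseRange_denseSeq Ω).closure_range
    have hsub : Set.range p ⊆ {q : Ω | ENNReal.ofReal |inner ℝ g (outerVec q.1 q.2)|
        ≤ ⨆ k, f k g} := by
      rintro _ ⟨k, rfl⟩
      exact le_iSup (fun i => f i g) k
    have := hcl.closure_subset_iff.2 hsub (hall.symm ▸ Set.mem_univ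
      ((⟨u, by simpa using hu⟩, ⟨v, by simpa using hv⟩) : Ω))
    exact this

theorem abs_inner_outerVec_le {g : EuclideanSpace ℝ (Fin m × Fin n)} {M : ℝ}
    (hM : ∀ u v, ‖u‖ = 1 → ‖v‖ = 1 → |inner ℝ g (outerVec u v)| ≤ M)
    {u : EuclideanSpace ℝ (Fin m)} (hu : ‖u‖ = 1) (w : EuclideanSpace ℝ (Fin n)) :
    |inner ℝ g (outerVec u w)| ≤ M * ‖w‖ := by
  rcases eq_or_ne w 0 with rfl | hw
  · have h1 : outerVec u (0 : EuclideanSpace ℝ (Fin n)) = 0 := by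
      rw [← norm_eq_zero, norm_outerVec, norm_zero, mul_zero]
    rw [h1]
    simp
  · have h1 : outerVec u w = ‖w‖ • outerVec u (‖w‖⁻¹ • w) := by
      rw [← outerVec_smul_right, smul_smul, mul_inv_cancel₀ (norm_ne_zero_iff.2 hw), one_smul]
    rw [h1, inner_smul_right, abs_mul, abs_norm, mul_comm]
    exact mul_le_mul_of_nonneg_right (hM _ _ hu (norm_smul_inv_norm hw)) (norm_nonneg _)

/-- The `l`-th column of a matrix. -/
noncomputable def colVec (X : EuclideanSpace ℝ (Fin m × Fin n)) (l : Fin n) :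
    EuclideanSpace ℝ (Fin m) := WithLp.toLp 2 fun i => X (i, l)

/-- Expanding the columns in an orthonormal basis `e` of `W` gives `X = ∑ e_k w_kᵀ` with `‖X‖² = ∑
‖w_k‖²`. This replaces the singular value decomposition: each term costs `M ‖w_k‖`, and
Cauchy–Schwarz over at most `r` terms gives `√r`. -/
theorem abs_inner_le_of_colVec_mem {W : Submodule ℝ (EuclideanSpace ℝ (Fin m))} {r : ℕ}
    (hW : Module.finrank ℝ W ≤ r) {X g : EuclideanSpace ℝ (Fin m × Fin n)}
    (hX : ∀ l, colVec X l ∈ W) {M : ℝ} (hM0 : 0 ≤ M)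
    (hM : ∀ u v, ‖u‖ = 1 → ‖v‖ = 1 → |inner ℝ g (outerVec u v)| ≤ M) :
    |inner ℝ g X| ≤ √r * ‖X‖ * M := by
  let e := stdOrthonormalBasis ℝ W
  let w : Fin (Module.finrank ℝ W) → EuclideanSpace ℝ (Fin n) := fun k =>
    WithLp.toLp 2 fun l => inner ℝ (e k) ⟨colVec X l, hX l⟩
  have hXsum : X = ∑ k, outerVec (e k : EuclideanSpace ℝ (Fin m)) (w k) := by
    ext ⟨i, l⟩
    have h := congrArg (fun x : W => (x : EuclideanSpace ℝ (Fin m)) i)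
      (e.sum_repr' ⟨colVec X l, hX l⟩)
    simp only [Submodule.coe_sum, Submodule.coe_smul, WithLp.ofLp_sum, Finset.sum_apply,
      PiLp.smul_apply, smul_eq_mul] at h
    simp only [WithLp.ofLp_sum, Finset.sum_apply, outerVec]
    refine h.symm.trans (Finset.sum_congr rfl fun k _ => mul_comm _ _)
  have hXnorm : ‖X‖ ^ 2 = ∑ k, ‖w k‖ ^ 2 := by
    simp only [EuclideanSpace.real_norm_sq_eq, w]
    rw [Finset.sum_comm, Fintype.sum_prod_type_right]
    refine Finset.sum_congr rfl fun l _ => ?_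
    rw [e.sum_sq_inner_right, Submodule.coe_norm, EuclideanSpace.real_norm_sq_eq]
    rfl
  clear_value w
  have hterm : ∀ k, |inner ℝ g (outerVec (e k : EuclideanSpace ℝ (Fin m)) (w k))|
      ≤ M * ‖w k‖ := fun k => abs_inner_outerVec_le hM (e.norm_eq_one k) (w k)
  have hsum : ∑ k, ‖w k‖ ≤ √r * ‖X‖ := by
    have h1 : (∑ k, ‖w k‖) ^ 2 ≤ r * ‖X‖ ^ 2 := by
      have h := sq_sum_le_card_mul_sum_sq (s := Finset.univ) (f := fun k => ‖w k‖)
      rw [Finset.card_univ, Fintype.card_fin, ← hXnorm] at h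
      exact h.trans (mul_le_mul_of_nonneg_right (Nat.cast_le.2 hW) (sq_nonneg _))
    refine (pow_le_pow_iff_left₀ (Finset.sum_nonneg fun _ _ => norm_nonneg _) (by positivity)
      two_ne_zero).1 ?_
    rwa [mul_pow, Real.sq_sqrt (Nat.cast_nonneg _)]
  calc |inner ℝ g X| ≤ ∑ k, |inner ℝ g (outerVec (e k : EuclideanSpace ℝ (Fin m)) (w k))| := by
        conv_lhs => rw [hXsum, inner_sum]
        exact Finset.abs_sum_le_sum_abs _ _
    _ ≤ ∑ k, M * ‖w k‖ := Finset.sum_le_sum fun k _ => hterm k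
    _ = M * ∑ k, ‖w k‖ := (Finset.mul_sum _ _ _).symm
    _ ≤ M * (√r * ‖X‖) := by gcongr
    _ = √r * ‖X‖ * M := mul_comm _ _

theorem exists_finrank_le_of_mem_lowRankSet {s : ℕ} {X : EuclideanSpace ℝ (Fin m × Fin n)}
    (hX : X ∈ lowRankSet s m n) : ∃ W : Submodule ℝ (EuclideanSpace ℝ (Fin m)),
      Module.finrank ℝ W ≤ s ∧ ∀ l, colVec X l ∈ W := by
  have h : (Matrix.of fun i j => X (i, j)).rank ≤ s := hX
  rw [Matrix.rank_eq_finrank_span_cols] at h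
  refine ⟨Submodule.map (WithLp.linearEquiv 2 ℝ (Fin m → ℝ)).symm.toLinearMap _,
    (LinearEquiv.finrank_map_eq _ _).trans_le h, fun l => ?_⟩
  exact Submodule.mem_map_of_mem (Submodule.subset_span ⟨l, rfl⟩)

theorem gaussianWidth_lowRankSet_le {s : ℕ} {Xu : EuclideanSpace ℝ (Fin m × Fin n)}
    (hXu1 : ‖Xu‖ = 1) (hXu : Xu ∈ lowRankSet s m n) :
    gaussianWidth (sphericalTangent (lowRankSet s m n) Xu)
      ≤ ENNReal.ofReal (√(2 * s * m) + √(2 * s * n)) := by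
  -- A unit matrix has an entry, so both dimensions are positive, as Chevet's bound requires.
  have hne : Nonempty (Fin m × Fin n) := by
    by_contra h
    rw [not_nonempty_iff] at h
    simp [Subsingleton.elim Xu 0] at hXu1
  obtain ⟨⟨i₀, j₀⟩⟩ := hne
  obtain ⟨M, hMint, hMtop, hM⟩ := exists_bound_inner_outerVec (m := m) (n := n)
    (by have := i₀.2; omega) (by have := j₀.2; omega)
  obtain ⟨W₀, hW₀, hXuW⟩ := exists_finrank_le_of_mem_lowRankSet hXu
  have hpt : ∀ g, ⨆ v ∈ sphericalTangent (lowRankSet s m n) Xu, ENNReal.ofReal |inner ℝ g v|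
      ≤ ENNReal.ofReal √(2 * s) * M g := by
    refine fun g => iSup₂_le fun v hv => ?_
    obtain ⟨⟨α, -, X, hX, rfl⟩, hv1⟩ := hv
    rw [mem_sphere_zero_iff_norm] at hv1
    obtain ⟨W, hW, hXW⟩ := exists_finrank_le_of_mem_lowRankSet hX.1
    have hrank : Module.finrank ℝ (W ⊔ W₀ : Submodule ℝ _) ≤ 2 * s :=
      (Submodule.finrank_add_le_finrank_add_finrank W W₀).trans (by omega)
    have hcol : ∀ l, colVec (α • (X - Xu)) l ∈ W ⊔ W₀ := fun l => by
      have : colVec (α • (X - Xu)) l = α • (colVec X l - colVec Xu l) := by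
        ext i
        simp [colVec]
      rw [this]
      exact Submodule.smul_mem _ _ (Submodule.sub_mem _ (Submodule.mem_sup_left (hXW l))
        (Submodule.mem_sup_right (hXuW l)))
    have h := abs_inner_le_of_colVec_mem hrank hcol (g := g) ENNReal.toReal_nonneg
      fun u v hu hv => (ENNReal.ofReal_le_iff_le_toReal (hMtop g)).1 (hM g u v hu hv)
    rw [hv1, mul_one] at h
    refine (ENNReal.ofReal_le_ofReal h).trans_eq ?_
    rw [ENNReal.ofReal_mul (Real.sqrt_nonneg _), ENNReal.ofReal_toReal (hMtop g)]
    norm_num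
  refine (lintegral_mono hpt).trans ?_
  rw [lintegral_const_mul' _ _ ENNReal.ofReal_ne_top]
  refine (mul_le_mul_right hMint _).trans_eq ?_
  rw [← ENNReal.ofReal_mul (Real.sqrt_nonneg _), mul_add, ← Real.sqrt_mul (by positivity),
    ← Real.sqrt_mul (by positivity)]

end Chevet

/-! ### The five bounds assembled -/

theorem mainTheorem7 :
    -- sparse signals
    (∀ (n s : ℕ) (xu : EuclideanSpace ℝ (Fin n)), 1 ≤ s → 2 * s ≤ n → ‖xu‖ = 1 →
      xu ∈ sparseSet s n →
      gaussianWidth (sphericalTangent (sparseSet s n) xu)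
          ≤ gaussianWidth (sparseSet (2 * s) n ∩ Metric.sphere 0 1) ∧
      gaussianWidth (sparseSet (2 * s) n ∩ Metric.sphere 0 1)
          ≤ ENNReal.ofReal (√(2 * s) + √(4 * s * Real.log (Real.exp 1 * n / (2 * s)))
              + √(Real.pi / 2)) ∧
      √(2 * s) + √(4 * s * Real.log (Real.exp 1 * n / (2 * s))) + √(Real.pi / 2)
          ≤ 3.5 * √(2 * s * Real.log (Real.exp 1 * n / (2 * s)))) ∧
    -- piecewise constant signals
    (∀ (n s : ℕ) (xu : EuclideanSpace ℝ (Fin n)), 1 ≤ s → 2 * s ≤ n → ‖xu‖ = 1 →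
      xu ∈ piecewiseConstantSet s n →
      gaussianWidth (sphericalTangent (piecewiseConstantSet s n) xu)
          ≤ ENNReal.ofReal (√(2 * s) + √(4 * s * Real.log (Real.exp 1 * n / (2 * s)))
              + √(Real.pi / 2)) ∧
      gaussianWidth (sphericalTangent (piecewiseConstantSet s n) xu)
          ≤ ENNReal.ofReal (3.5 * √(2 * s * Real.log (Real.exp 1 * n / (2 * s))))) ∧
    -- group-sparse signals
    (∀ (n L s : ℕ) (G : Fin L → Finset (Fin n)) (xu : EuclideanSpace ℝ (Fin n)),
      (∀ k l, k ≠ l → Disjoint (G k) (G l)) → (∀ j, ∃ l, j ∈ G l) →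
      1 ≤ s → 2 * s ≤ L → ‖xu‖ = 1 → xu ∈ groupSparseSet G s →
      gaussianWidth (sphericalTangent (groupSparseSet G s) xu)
          ≤ ENNReal.ofReal (2 * √(2 * s * (Finset.univ.sup fun l => (G l).card : ℕ))
              + √(4 * s * Real.log (Real.exp 1 * L / (2 * s))))) ∧
    -- low-rank matrices
    (∀ (n₁ n₂ s : ℕ) (Xu : EuclideanSpace ℝ (Fin n₁ × Fin n₂)), ‖Xu‖ = 1 →
      Xu ∈ lowRankSet s n₁ n₂ →
      gaussianWidth (sphericalTangent (lowRankSet s n₁ n₂) Xu)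
          ≤ ENNReal.ofReal (√(2 * s * n₁) + √(2 * s * n₂))) ∧
    -- the convex constraint given by the l1-ball, for a sparse signal
    (∀ (n s : ℕ) (xu : EuclideanSpace ℝ (Fin n)), ‖xu‖ = 1 → xu ∈ sparseSet s n →
      gaussianWidth (sphericalTangent (l1Ball (l1norm xu) n) xu)
          ≤ ENNReal.ofReal (2 * √2) * gaussianWidth (sparseSet (2 * s) n ∩ Metric.sphere 0 1) ∧
      (2 * s ≤ n →
        gaussianWidth (sphericalTangent (l1Ball (l1norm xu) n) xu)
          ≤ ENNReal.ofReal
              (2 * √2 * (3.5 * √(2 * s * Real.log (Real.exp 1 * n / (2 * s))))))) := by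
  refine ⟨fun n s xu hs hsn _ hxu => ⟨gaussianWidth_mono (sphericalTangent_sparseSet_subset hxu),
      (gaussianWidth_sparseSet_le hs hsn).trans (ENNReal.ofReal_le_ofReal
        (le_add_of_nonneg_right (Real.sqrt_nonneg _))), sqrt_add_sqrt_log_le hs hsn⟩,
    fun n s xu hs hsn _ hxu => ⟨gaussianWidth_piecewiseConstantSet_le hs hsn hxu,
      (gaussianWidth_piecewiseConstantSet_le hs hsn hxu).trans
        (ENNReal.ofReal_le_ofReal (sqrt_add_sqrt_log_le hs hsn))⟩,
    fun n L s G xu _ hG hs hsL hxu1 hxu =>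
      (gaussianWidth_groupSparseSet_le G hG hs hsL hxu1 hxu).trans
        (ENNReal.ofReal_le_ofReal (add_le_add_left
          (le_mul_of_one_le_left (Real.sqrt_nonneg _) one_le_two) _)),
    fun n₁ n₂ s Xu hXu1 hXu => gaussianWidth_lowRankSet_le hXu1 hXu,
    fun n s xu hxu1 hxu => ⟨gaussianWidth_l1Ball_le hxu1 hxu, fun hsn => ?_⟩⟩
  have hs := one_le_of_mem_sparseSet hxu1 hxu
  refine (gaussianWidth_l1Ball_le hxu1 hxu).trans ?_
  rw [ENNReal.ofReal_mul (p := 2 * √2) (by positivity)]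
  exact mul_le_mul_right ((gaussianWidth_sparseSet_le hs hsn).trans (ENNReal.ofReal_le_ofReal
    ((le_add_of_nonneg_right (Real.sqrt_nonneg _)).trans (sqrt_add_sqrt_log_le hs hsn)))) _
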